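/- **Setting.** Let $Z=(Y,X,A)$ with $Y\in\mathcal Y\subseteq\mathbb R$, $X\in\mathcal X\subseteq\mathbb R^d$, $A\in\{0,1\}$, propensity score $\pi(x)=P(A=1\mid X=x)\in(0,1)$ and conditional CDFs $F_a(y\mid x)=P(Y\le y\mid X=x,A=a)$; assume that $Y$ given $X=x',A=a$ is supported in $\mathcal Y$ and has a Lebesgue density for all $x'\in\mathcal X$, $a\in\{0,1\}$, and write $f_1(\cdot\mid x')$ for the density when $a=1$. Let $h^*(y_0,y_1\mid x)=F_1(y_1\mid x)-F_0(y_0\mid x)$, and let $g^*:\mathcal Y\times\mathcal X\to\mathcal Y$ be a measurable function with $F_1(g^*(y\mid x)\mid x)=F_0(y\mid x)$ for all $y\in\mathcal Y$, $x\in\mathcal X$. Let $Z_1,Z_2,\dots$ be i.i.d. copies of $Z$; for each $n$ the sample $Z_1,\dots,Z_{2n}$ is split into $D_1=(Z_1,\dots,Z_n)$ and $D_2=(Z_{n+1},\dots,Z_{2n})$. Fix $x\in\mathcal X$. **Estimators.** For $r>0$ let $k_r(x,x')=\mathbf 1\{\|x-x'\|\le r\}$ be the box kernel, let $\alpha,\beta>0$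 and $\gamma\in(0,1]$, and put $r_\gamma=n^{-1/(2\gamma+d)}$, $r_\beta=n^{-1/(2\beta+d)}$. Let $\hat\pi$ be any propensity estimate built (measurably) from $D_1$, and let $$\hat F_a(y\mid x')=\sum_{i\le n}\frac{k_{r_\beta}(x',X_i)\mathbf 1\{A_i=a\}}{\sum_{j\le n}k_{r_\beta}(x',X_j)\mathbf 1\{A_j=a\}}\mathbf 1\{Y_i\le y\}.$$ The pseudo-outcome is, with $y_a$ denoting $y_1$ if $a=1$ and $y_0$ if $a=0$, $$\varphi_{y_0,y_1}(y,x',a)=\frac{a-\pi(x')}{\pi(x')(1-\pi(x'))}\bigl\{\mathbf 1\{y\le y_a\}-F_a(y_a\mid x')\bigr\}+F_1(y_1\mid x')-F_0(y_0\mid x'),$$ $\hat\varphi$ is the same with $\hat\pi,\hat F_a$ in place of $\pi,F_a$, and $$\hat h(y_0,y_1\mid x)=\sum_{j=n+1}^{2n}w_j\hat\varphi_{y_0,y_1}(Z_j),\qquad w_j=\frac{k_{r_\gamma}(x,X_j)}{\sum_{i=n+1}^{2n}k_{r_\gamma}(x,X_i)}$$ (with $0/0=0$ throughout). Let $y^{(1)}\le\dots\le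 y^{(p)}$ be the sorted responses of the treated individuals among all $2n$, let $\tilde\alpha$ be the Euclidean projection of $(\hat h(y,y^{(l)}\mid x))_{l\le p}$ onto the non-decreasing vectors, and let $\hat g(y\mid x)=y^{(l^*)}$ with $l^*$ the smallest minimiser of $|\tilde\alpha_l|$ (and $\hat g(y\mid x)=y$ if $p=0$). For a function $\phi$ of $z$, treated as deterministic, let $\|\phi\|_{w^s}^2=\|w^s\|_1^{-1}\sum_j w_j^s\,E[\phi(Z)^2\mid X=X_j]$ and $\|\phi\|_w=\|\phi\|_{w^1}$. **Assumptions.** There are $\xi\in(0,\tfrac12]$, $C\ge1$, $C_\alpha,C_\beta,C_0,C''>0$ such that, for all $n\ge1$ and $\delta\in(0,e^{-1})$: * $\pi(x')\in[\xi,1-\xi]$ and, almost surely, $\hat\pi(x')\in[\xi,1-\xi]$, for all $x'\in\mathcal X$; * for all $y_0,y_1\in\mathcal Y$, with probability at least $1-\delta$, $\|\hat\varphi_{y_0,y_1}-\varphi_{y_0,y_1}\|_{w^2}\le e_{\hat\varphi}(n)\sqrt{\log(1/\delta)}$, where $e_{\hat\varphi}(n)=o(1)$; * for all $a\in\{0,1\}$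 and $y\in\mathcal Y$, with probability at least $1-\delta$, $\|\hat\pi-\pi\|_w\le C_\alpha\sqrt{\log(1/\delta)}\,n^{-1/(2+d/\alpha)}$ and $\|\hat F_a(y\mid\cdot)-F_a(y\mid\cdot)\|_w\le C_\beta\sqrt{\log(1/\delta)}\,n^{-1/(2+d/\beta)}$; * for all $y_0,y_1\in\mathcal Y$ and $x',x''\in\mathcal X$, $|h^*(y_0,y_1\mid x')-h^*(y_0,y_1\mid x'')|\le C\|x'-x''\|^\gamma$; * there are $r_0>0$ and $c:\mathcal X\to(0,\infty)$ with $c(x)=C_0$ such that $P(\|X-x'\|\le r)\ge c(x')r^d$ for all $x'\in\mathcal X$, $r\in(0,r_0)$, and, with probability at least $1-\delta$, $1/c(X)\le C''\sqrt{\log(1/\delta)}$; * $\beta>\dfrac{d}{2(1+d/\gamma)}$. **Claim.** Put $e_h(n)=\min\{n^{1/(2+d/\gamma)},\,n^{1/(2+d/\alpha)+1/(2+d/\beta)}\}$. There are constants $C_h,C_g,C_{g,2}>0$ depending only on $C,C_\alpha,C_\beta,C_0,C''$ such that the following hold. 1. There is $n_0$ such that for all $n\ge n_0$, $\delta\in(0,e^{-1})$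 and $y_0,y_1\in\mathcal Y$, with probability at least $1-\delta$, $$|\hat h(y_0,y_1\mid x)-h^*(y_0,y_1\mid x)|\le\frac{C_h}{\xi}\,\frac{\log^{3/2}(1/\delta)}{e_h(n)}.$$ 2. Let $y\in\mathcal Y$ and $s,\eta>0$ be such that $f_1(y'\mid x)\ge\eta$ for almost every $y'$ with $|y'-g^*(y\mid x)|<s$. Then for every $\delta\in(0,e^{-1})$ there is $n_0$ such that for all $n\ge n_0$, with probability at least $1-\delta$, $$|\hat g(y\mid x)-g^*(y\mid x)|\le\frac{C_g}{\xi\eta}\,\frac{\log^{3/2}(n/\delta)}{e_h(n)}.$$ 3. Let $\mathcal Y$ be an interval and let $\eta>0$ be such that $f_1(y'\mid x)\ge\eta$ for almost every $y'\in\mathcal Y$ (so that $\mathcal Y$ is bounded). Then there is $n_0$ such that for all $n\ge n_0$ and $\delta\in(0,e^{-1})$, with probability at least $1-\delta$, $$E\bigl[\,|\hat g(Y\mid x)-g^*(Y\mid x)|\ \big|\ A=0,\hat g\,\bigr]\le\frac{C_{g,2}\operatorname{diam}(\mathcal Y)}{\xi\eta}\,\frac{\log^{3/2}(e_h(n)\,n/\delta)}{e_h(n)},$$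 where $(Y,X,A)$ is a fresh copy of $Z$, independent of the sample. -/

import Mathlib

open MeasureTheory ProbabilityTheory Filter Topology

noncomputable section

/-- The space `ℝ^d` of covariates, with the Euclidean norm. -/
abbrev Cov (d : ℕ) := EuclideanSpace ℝ (Fin d)

/-- An observation `z = (y, x, a)`: response, covariates, treatment (`true` is `a = 1`). -/
abbrev Obs (d : ℕ) := ℝ × Cov d × Bool

/-- The law of `Z = (Y, X, A)`, given by the law of `X`, the propensity score
`π(x) = P(A = 1 | X = x)` and the conditional laws of `Y` given `X = x`, `A = a`. -/
structure CausalModel (d : ℕ) where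
  covLaw : Measure (Cov d)
  isProb : IsProbabilityMeasure covLaw
  propensity : Cov d → ℝ
  measurable_propensity : Measurable propensity
  propensity_mem : ∀ x, propensity x ∈ Set.Ioo (0 : ℝ) 1
  outcome : Bool → Kernel (Cov d) ℝ
  isMarkov : ∀ a, IsMarkovKernel (outcome a)

attribute [instance] CausalModel.isProb CausalModel.isMarkov

namespace CausalModel

variable {d : ℕ} (M : CausalModel d)

/-- The joint law of `Z = (Y, X, A)`. -/
def law : Measure (Obs d) :=
  ((M.covLaw.withDensity fun x => ENNReal.ofReal (M.propensity x)) ⊗ₘ M.outcome true).map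
      (fun p => (p.2, p.1, true)) +
  ((M.covLaw.withDensity fun x => ENNReal.ofReal (1 - M.propensity x)) ⊗ₘ M.outcome false).map
      (fun p => (p.2, p.1, false))

/-- The conditional CDF `F_a(y | x) = P(Y ≤ y | X = x, A = a)`. -/
def ccdf (a : Bool) (y : ℝ) (x : Cov d) : ℝ := (M.outcome a x).real (Set.Iic y)

/-- The contrasting function `h*(y₀, y₁ | x) = F₁(y₁ | x) - F₀(y₀ | x)`. -/
def contrast (y₀ y₁ : ℝ) (x : Cov d) : ℝ := M.ccdf true y₁ x - M.ccdf false y₀ x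

/-- The conditional density of `Y` given `X = x`, `A = 1`, with respect to Lebesgue measure. -/
def treatedDensity (x : Cov d) (y : ℝ) : ENNReal := (M.outcome true x).rnDeriv volume y

/-- The conditional mean `E[f(Z) | X = x]`. -/
def condMean (f : Obs d → ℝ) (x : Cov d) : ℝ :=
  M.propensity x * ∫ y, f (y, x, true) ∂(M.outcome true x) +
    (1 - M.propensity x) * ∫ y, f (y, x, false) ∂(M.outcome false x)

/-- The conditional law of `Y` given `A = 0`. -/
def untreatedLaw : Measure ℝ := (M.law[|{z : Obs d | z.2.2 = false}]).map Prod.fst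

/-- `g` is the conditional quantile comparator `g* : 𝒴 × 𝒳 → 𝒴`. -/
def IsCQC (𝒴 : Set ℝ) (𝒳 : Set (Cov d)) (g : ℝ → Cov d → ℝ) : Prop :=
  Measurable (Function.uncurry g) ∧
    ∀ y ∈ 𝒴, ∀ x ∈ 𝒳, g y x ∈ 𝒴 ∧ M.ccdf true (g y x) x = M.ccdf false y x

/-- The norm `‖f‖_{w^s}`, with `f` treated as deterministic and `w` the weights on the points
`X_j`. -/
def wNorm {n : ℕ} (w : Fin n → ℝ) (s : ℕ) (X : Fin n → Cov d) (f : Obs d → ℝ) : ℝ :=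
  √((∑ j, |w j ^ s|)⁻¹ * ∑ j, w j ^ s * M.condMean (fun z => f z ^ 2) (X j))

end CausalModel

section Estimators

variable {d n : ℕ}

/-- The box kernel `k_r(x, x') = 1{‖x - x'‖ ≤ r}`. -/
def boxKernel (r : ℝ) (x x' : Cov d) : ℝ := if ‖x - x'‖ ≤ r then 1 else 0

/-- The optimally decaying radius `n^{-1/(2s+d)}` for a function of smoothness `s`. -/
def optRadius (d : ℕ) (s : ℝ) (n : ℕ) : ℝ := (n : ℝ) ^ (-(1 / (2 * s + d)))

/-- Nadaraya-Watson weights at `x`; they all vanish if no point lies in the box. -/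
def nwWeight (r : ℝ) (x : Cov d) (X : Fin n → Cov d) (j : Fin n) : ℝ :=
  boxKernel r x (X j) / ∑ i, boxKernel r x (X i)

/-- Nadaraya-Watson estimate of `F_a(y | x)` from the observations `D` with treatment `a`. -/
def ccdfHat (r : ℝ) (D : Fin n → Obs d) (a : Bool) (y : ℝ) (x : Cov d) : ℝ :=
  ∑ i, (boxKernel r x (D i).2.1 * (if (D i).2.2 = a then 1 else 0)) /
      (∑ j, boxKernel r x (D j).2.1 * (if (D j).2.2 = a then 1 else 0)) *
    (if (D i).1 ≤ y then 1 else 0)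

/-- The pseudo-outcome `φ_{y₀,y₁}(y, x, a)` built from a propensity score `p` and conditional
CDFs `F`. -/
def pseudoOutcome (p : Cov d → ℝ) (F : Bool → ℝ → Cov d → ℝ) (y₀ y₁ : ℝ) (z : Obs d) : ℝ :=
  let x := z.2.1
  let a := z.2.2
  let ya := if a then y₁ else y₀
  ((if a then 1 else 0) - p x) / (p x * (1 - p x)) * ((if z.1 ≤ ya then 1 else 0) - F a ya x) +
    F true y₁ x - F false y₀ x

/-- The doubly robust estimate `ĥ(y₀, y₁ | x)`: the conditional CDFs are estimated on `D₁` with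
radius `rF`, `p` is the estimated propensity score, and the estimated pseudo-outcome is regressed
on the covariates over `D₂` with radius `rh`. -/
def contrastHat (rh rF : ℝ) (p : Cov d → ℝ) (D₁ D₂ : Fin n → Obs d) (y₀ y₁ : ℝ) (x : Cov d) : ℝ :=
  ∑ j, nwWeight rh x (fun i => (D₂ i).2.1) j * pseudoOutcome p (ccdfHat rF D₁) y₀ y₁ (D₂ j)

/-- `v` is a Euclidean projection of `u` onto the isotonic vectors. -/
def IsIsotonicProj {p : ℕ} (u v : Fin p → ℝ) : Prop :=
  Monotone v ∧ ∀ w : Fin p → ℝ, Monotone w → ∑ l, (v l - u l) ^ 2 ≤ ∑ l, (w l - u l) ^ 2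

theorem exists_isIsotonicProj {p : ℕ} (u : Fin p → ℝ) : ∃ v, IsIsotonicProj u v := by
  let S : Set (EuclideanSpace ℝ (Fin p)) := {v | Monotone fun l => v l}
  have hS : IsClosed S := by
    have h : S = ⋂ (i : Fin p) (j : Fin p) (_ : i ≤ j), {v | v i ≤ v j} := by
      ext v
      simp [S, Monotone]
    rw [h]
    refine isClosed_iInter fun i => isClosed_iInter fun j => isClosed_iInter fun _ => ?_
    exact isClosed_le (by fun_prop) (by fun_prop)
  have hne : S.Nonempty := ⟨0, fun i j _ => by simp⟩
  obtain ⟨v, hv, hd⟩ := hS.exists_infDist_eq_dist hne (WithLp.toLp 2 u)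
  refine ⟨fun l => v l, hv, fun w hw => ?_⟩
  have h1 : dist (WithLp.toLp 2 u) v ≤ dist (WithLp.toLp 2 u) (WithLp.toLp 2 w) := by
    rw [← hd]
    exact Metric.infDist_le_dist_of_mem hw
  rw [EuclideanSpace.dist_eq, EuclideanSpace.dist_eq] at h1
  have h2 := (Real.sqrt_le_sqrt_iff (Finset.sum_nonneg fun _ _ => sq_nonneg _)).1 h1
  simpa [Real.dist_eq, sq_abs, sub_sq_comm] using h2

/-- The isotonic projection (the minimiser is unique, the set of isotonic vectors being convex). -/
def isotonicProj {p : ℕ} (u : Fin p → ℝ) : Fin p → ℝ := (exists_isIsotonicProj u).choose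

/-- The evaluation points: the responses of the treated individuals of the whole sample, sorted. -/
def evalPoints (D₁ D₂ : Fin n → Obs d) : List ℝ :=
  (((List.ofFn D₁ ++ List.ofFn D₂).filter fun z => z.2.2).map Prod.fst).insertionSort (· ≤ ·)

/-- The indices at which the entry of `v` is closest to zero. -/
def absMinimisers {p : ℕ} (v : Fin p → ℝ) : Finset (Fin p) :=
  open scoped Classical in Finset.univ.filter fun l => ∀ m, |v l| ≤ |v m|

/-- The estimate `ĝ(y | x)`: the evaluation point at which the isotonic projection of
`ĥ(y, · | x)` is closest to zero. Ties go to the smallest index; if nobody is treated (there are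
no evaluation points) the value is `y`. -/
def cqcHat (rh rF : ℝ) (p : Cov d → ℝ) (D₁ D₂ : Fin n → Obs d) (y : ℝ) (x : Cov d) : ℝ :=
  let pts := evalPoints D₁ D₂
  let v := isotonicProj fun l : Fin pts.length => contrastHat rh rF p D₁ D₂ y (pts.get l) x
  if h : (absMinimisers v).Nonempty then pts.get ((absMinimisers v).min' h) else y

end Estimators

/-- `e_h(n)`, the inverse of the larger of the oracle rate `n^{-1/(2+d/γ)}` and the product
`n^{-1/(2+d/α)} n^{-1/(2+d/β)}` of the two nuisance rates. -/
def contrastRate (d : ℕ) (α β γ : ℝ) (n : ℕ) : ℝ :=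
  min ((n : ℝ) ^ (1 / (2 + d / γ))) ((n : ℝ) ^ (1 / (2 + d / α) + 1 / (2 + d / β)))

/-- The first half `(Z_1, …, Z_n)` of the sample of size `2n`. -/
def firstSplit {d : ℕ} {Ω : Type*} (Z : ℕ → Ω → Obs d) (n : ℕ) (ω : Ω) : Fin n → Obs d :=
  fun i => Z i ω

/-- The second half `(Z_{n+1}, …, Z_{2n})` of the sample of size `2n`. -/
def secondSplit {d : ℕ} {Ω : Type*} (Z : ℕ → Ω → Obs d) (n : ℕ) (ω : Ω) : Fin n → Obs d :=
  fun i => Z (n + i) ω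

/-- The hypotheses of the accuracy result. `𝒳` and `𝒴` are the covariate and response spaces,
`x` is the point at which the estimators are evaluated, `Z` is the i.i.d. data, and `piHat n D` is
the propensity estimate built from the first split `D`; "with probability at least `1 - δ`" is
rendered by bounding the probability of the complement by `δ`. -/
structure NWAssumptions {d : ℕ} (M : CausalModel d) (𝒳 : Set (Cov d)) (𝒴 : Set ℝ) (x : Cov d)
    {Ω : Type*} [MeasurableSpace Ω] (P : Measure Ω) (Z : ℕ → Ω → Obs d)
    (piHat : (n : ℕ) → (Fin n → Obs d) → Cov d → ℝ)
    (α β γ ξ C Cα Cβ C₀ C₂ : ℝ) : Prop where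
  measurableSet_covariates : MeasurableSet 𝒳
  measurableSet_responses : MeasurableSet 𝒴
  mem_covariates : x ∈ 𝒳
  covLaw_compl : M.covLaw 𝒳ᶜ = 0
  outcome_compl : ∀ a, ∀ x' ∈ 𝒳, M.outcome a x' 𝒴ᶜ = 0
  /-- `Y` given `X = x'`, `A = a` has a density. -/
  outcome_ac : ∀ a, ∀ x' ∈ 𝒳, M.outcome a x' ≪ volume
  /-- The data are i.i.d. copies of `Z`. -/
  measurable_data : ∀ i, Measurable (Z i)
  indep_data : iIndepFun Z P
  law_data : ∀ i, P.map (Z i) = M.law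
  measurable_piHat : ∀ n, Measurable (Function.uncurry (piHat n))
  smoothness_α : 0 < α
  smoothness_β : 0 < β
  smoothness_γ : γ ∈ Set.Ioc (0 : ℝ) 1
  /-- Overlap for the propensity score and its estimate. -/
  overlap_const : ξ ∈ Set.Ioc (0 : ℝ) (1 / 2)
  overlap : ∀ x' ∈ 𝒳, M.propensity x' ∈ Set.Icc ξ (1 - ξ)
  overlap_hat : ∀ n, ∀ᵐ ω ∂P, ∀ x' ∈ 𝒳, piHat n (firstSplit Z n ω) x' ∈ Set.Icc ξ (1 - ξ)
  /-- Accuracy of the estimated pseudo-outcome, `ε_φ(n, δ) = e_φ(n) √log(1/δ)`, `e_φ = o(1)`. -/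
  pseudo_rate : ∃ e : ℕ → ℝ, Tendsto e atTop (𝓝 0) ∧
    ∀ y₀ ∈ 𝒴, ∀ y₁ ∈ 𝒴, ∀ n : ℕ, 1 ≤ n → ∀ δ ∈ Set.Ioo (0 : ℝ) (Real.exp (-1)),
      P {ω | ¬ M.wNorm
          (nwWeight (optRadius d γ n) x fun i => (secondSplit Z n ω i).2.1) 2
          (fun i => (secondSplit Z n ω i).2.1)
          (fun z =>
            pseudoOutcome (piHat n (firstSplit Z n ω))
              (ccdfHat (optRadius d β n) (firstSplit Z n ω)) y₀ y₁ z -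
            pseudoOutcome M.propensity M.ccdf y₀ y₁ z)
          ≤ e n * √(Real.log (1 / δ))} ≤ ENNReal.ofReal δ
  /-- Rates of the nuisance estimates, `ε_α(n, δ) = C_α √log(1/δ) n^{-1/(2+d/α)}` and
  `ε_β(n, δ) = C_β √log(1/δ) n^{-1/(2+d/β)}`. -/
  nuisance_rate : ∀ a, ∀ y ∈ 𝒴, ∀ n : ℕ, 1 ≤ n → ∀ δ ∈ Set.Ioo (0 : ℝ) (Real.exp (-1)),
      P {ω | ¬ (M.wNorm
          (nwWeight (optRadius d γ n) x fun i => (secondSplit Z n ω i).2.1) 1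
          (fun i => (secondSplit Z n ω i).2.1)
          (fun z => piHat n (firstSplit Z n ω) z.2.1 - M.propensity z.2.1)
            ≤ Cα * √(Real.log (1 / δ)) * (n : ℝ) ^ (-(1 / (2 + d / α))) ∧
        M.wNorm
          (nwWeight (optRadius d γ n) x fun i => (secondSplit Z n ω i).2.1) 1
          (fun i => (secondSplit Z n ω i).2.1)
          (fun z => M.ccdf a y z.2.1 - ccdfHat (optRadius d β n) (firstSplit Z n ω) a y z.2.1)
            ≤ Cβ * √(Real.log (1 / δ)) * (n : ℝ) ^ (-(1 / (2 + d / β))))} ≤ ENNReal.ofReal δ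
  /-- The contrasting function is `(γ, C)`-Hölder in the covariates. -/
  holder : ∀ y₀ ∈ 𝒴, ∀ y₁ ∈ 𝒴, ∀ x' ∈ 𝒳, ∀ x'' ∈ 𝒳,
    |M.contrast y₀ y₁ x' - M.contrast y₀ y₁ x''| ≤ C * ‖x' - x''‖ ^ γ
  /-- Small balls: `P(X ∈ B_r(x')) ≥ c(x') r^d` for `r < r₀`, with `c(x) = C₀`, and
  `1 / c(X) ≤ C₂ √log(1/δ)` with probability at least `1 - δ`. -/
  small_ball : ∃ (c : Cov d → ℝ) (r₀ : ℝ), 0 < r₀ ∧ c x = C₀ ∧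
    (∀ x' ∈ 𝒳, 0 < c x' ∧ ∀ r ∈ Set.Ioo 0 r₀,
      c x' * r ^ d ≤ M.covLaw.real (Metric.closedBall x' r)) ∧
    ∀ δ ∈ Set.Ioo (0 : ℝ) (Real.exp (-1)),
      M.covLaw {x' | ¬ 1 / c x' ≤ C₂ * √(Real.log (1 / δ))} ≤ ENNReal.ofReal δ
  /-- The smoothness condition on `β`. -/
  smoothness_cond : (d : ℝ) / (2 * (1 + d / γ)) < β

end

theorem measurable_boxKernel_comp {d : ℕ} {α : Type*} [MeasurableSpace α] (r : ℝ) {u v : α → Cov d}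
    (hu : Measurable u) (hv : Measurable v) : Measurable fun q => boxKernel r (u q) (v q) := by
  unfold boxKernel
  exact Measurable.ite (measurableSet_le (by fun_prop) (by fun_prop)) (by fun_prop) (by fun_prop)

theorem lintegral_pi_prod_eq_pow {α : Type*} [MeasurableSpace α] {ν : Measure α}
    [IsProbabilityMeasure ν] {G : α → ENNReal} (hG : Measurable G) (n : ℕ) :
    ∫⁻ D, ∏ j, G (D j) ∂(Measure.pi fun _ : Fin n => ν) = (∫⁻ z, G z ∂ν) ^ n := by
  have hind := iIndepFun_pi (μ := fun _ : Fin n => ν) (X := fun _ => G) (fun _ => hG.aemeasurable)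
  have hprod := lintegral_prod_eq_prod_lintegral_of_indepFun Finset.univ
    (fun (j : Fin n) (D : Fin n → α) => G (D j)) hind
    (fun j => hG.comp (measurable_pi_apply j))
  rw [hprod]
  have : ∀ j : Fin n, ∫⁻ D, G (D j) ∂(Measure.pi fun _ : Fin n => ν) = ∫⁻ z, G z ∂ν :=
    fun j => (measurePreserving_eval (fun _ : Fin n => ν) j).lintegral_comp hG
  simp only [this, Finset.prod_const, Finset.card_univ, Fintype.card_fin]

namespace CausalModel

variable {d : ℕ} (M : CausalModel d)

/-- The conditional law of `Z` given `X = x`. -/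
noncomputable def condLaw (x : Cov d) : Measure (Obs d) :=
  ENNReal.ofReal (M.propensity x) • (M.outcome true x).map (fun y => (y, x, true)) +
    ENNReal.ofReal (1 - M.propensity x) • (M.outcome false x).map (fun y => (y, x, false))

theorem propensity_pos (x : Cov d) : 0 < M.propensity x := (M.propensity_mem x).1

theorem propensity_lt_one (x : Cov d) : M.propensity x < 1 := (M.propensity_mem x).2

instance isProbabilityMeasure_condLaw (x : Cov d) : IsProbabilityMeasure (M.condLaw x) := by
  constructor
  rw [condLaw, Measure.add_apply, Measure.smul_apply, Measure.smul_apply,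
    Measure.map_apply (by fun_prop) MeasurableSet.univ,
    Measure.map_apply (by fun_prop) MeasurableSet.univ]
  simp only [Set.preimage_univ, measure_univ, smul_eq_mul, mul_one]
  rw [← ENNReal.ofReal_add (M.propensity_pos x).le (by linarith [M.propensity_lt_one x])]
  simp

theorem lintegral_condLaw {f : Obs d → ENNReal} (hf : Measurable f) (x : Cov d) :
    ∫⁻ z, f z ∂(M.condLaw x) =
      ENNReal.ofReal (M.propensity x) * ∫⁻ y, f (y, x, true) ∂(M.outcome true x) +
        ENNReal.ofReal (1 - M.propensity x) * ∫⁻ y, f (y, x, false) ∂(M.outcome false x) := by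
  rw [condLaw, lintegral_add_measure, lintegral_smul_measure, lintegral_smul_measure,
    lintegral_map hf (by fun_prop), lintegral_map hf (by fun_prop), smul_eq_mul, smul_eq_mul]

/-- The law of `Z` is the mixture of its conditional laws. -/
theorem lintegral_law {f : Obs d → ENNReal} (hf : Measurable f) :
    ∫⁻ z, f z ∂M.law = ∫⁻ x, ∫⁻ z, f z ∂(M.condLaw x) ∂M.covLaw := by
  have hp := M.measurable_propensity
  have h1 : Measurable fun x => ∫⁻ y, f (y, x, true) ∂(M.outcome true x) :=
    Measurable.lintegral_kernel_prod_right' (κ := M.outcome true)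
      (f := fun p : Cov d × ℝ => f (p.2, p.1, true)) (by fun_prop)
  have h2 : Measurable fun x => ∫⁻ y, f (y, x, false) ∂(M.outcome false x) :=
    Measurable.lintegral_kernel_prod_right' (κ := M.outcome false)
      (f := fun p : Cov d × ℝ => f (p.2, p.1, false)) (by fun_prop)
  simp_rw [M.lintegral_condLaw hf]
  rw [law, lintegral_add_measure, lintegral_map hf (by fun_prop), lintegral_map hf (by fun_prop),
    Measure.lintegral_compProd (by fun_prop), Measure.lintegral_compProd (by fun_prop),
    lintegral_withDensity_eq_lintegral_mul _ (by fun_prop) h1,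
    lintegral_withDensity_eq_lintegral_mul _ (by fun_prop) h2,
    ← lintegral_add_left (by fun_prop)]
  rfl

instance isProbabilityMeasure_law : IsProbabilityMeasure M.law := by
  constructor
  rw [← lintegral_one, M.lintegral_law measurable_const]
  simp

theorem integral_condLaw {f : Obs d → ℝ} (hf : Measurable f) {B : ℝ} (hB : ∀ z, |f z| ≤ B)
    (x : Cov d) : ∫ z, f z ∂(M.condLaw x) = M.condMean f x := by
  have hi : ∀ a : Bool, Integrable f ((M.outcome a x).map (fun y => (y, x, a))) := fun a =>
    have : IsFiniteMeasure ((M.outcome a x).map (fun y => (y, x, a))) := inferInstance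
    Integrable.of_bound hf.aestronglyMeasurable B (ae_of_all _ hB)
  rw [condLaw, integral_add_measure ((hi true).smul_measure ENNReal.ofReal_ne_top)
    ((hi false).smul_measure ENNReal.ofReal_ne_top), integral_smul_measure, integral_smul_measure,
    integral_map (by fun_prop) hf.aestronglyMeasurable,
    integral_map (by fun_prop) hf.aestronglyMeasurable,
    ENNReal.toReal_ofReal (M.propensity_pos x).le,
    ENNReal.toReal_ofReal (by linarith [M.propensity_lt_one x])]
  rfl

theorem measurable_condMean {α : Type*} [MeasurableSpace α] {f : α × Obs d → ℝ}
    (hf : Measurable f) :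
    Measurable fun p : α × Cov d => M.condMean (fun z => f (p.1, z)) p.2 := by
  have hp := M.measurable_propensity
  have h : ∀ a : Bool, Measurable fun p : α × Cov d =>
      ∫ y, f (p.1, y, p.2, a) ∂(M.outcome a p.2) := fun a =>
    (StronglyMeasurable.integral_kernel_prod_right'
      (κ := (M.outcome a).comap (Prod.snd : α × Cov d → Cov d) measurable_snd)
      (f := fun q : (α × Cov d) × ℝ => f (q.1.1, q.2, q.1.2, a))
      (by fun_prop : Measurable _).stronglyMeasurable).measurable
  have h1 := h true
  have h2 := h false
  unfold condMean
  fun_prop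

theorem measurable_condMean' {f : Obs d → ℝ} (hf : Measurable f) : Measurable (M.condMean f) :=
  (M.measurable_condMean (α := Unit) (f := fun q => f q.2) (by fun_prop)).comp
    (g := M.condMean f ∘ Prod.snd) (f := fun x : Cov d => ((), x)) (by fun_prop)

/-- Hoeffding's lemma for the conditional law. -/
theorem lintegral_exp_condLaw_le {f : Obs d → ℝ} (hf : Measurable f) {B : ℝ}
    (hB : ∀ z, |f z| ≤ B) (x : Cov d) (l : ℝ) :
    ∫⁻ z, ENNReal.ofReal (Real.exp (l * (f z - M.condMean f x))) ∂(M.condLaw x) ≤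
      ENNReal.ofReal (Real.exp (B ^ 2 * l ^ 2 / 2)) := by
  have hB0 : 0 ≤ B := (abs_nonneg _).trans (hB (0, 0, true))
  have h := hasSubgaussianMGF_of_mem_Icc (μ := M.condLaw x) (X := f) (a := -B) (b := B)
    hf.aemeasurable (ae_of_all _ fun z => abs_le.1 (hB z))
  rw [M.integral_condLaw hf hB] at h
  rw [← ofReal_integral_eq_lintegral_ofReal (h.integrable_exp_mul l)
    (ae_of_all _ fun _ => (Real.exp_pos _).le)]
  refine ENNReal.ofReal_le_ofReal ((h.mgf_le l).trans_eq ?_)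
  have : |B + B| = B + B := abs_of_nonneg (by linarith)
  simp only [NNReal.coe_pow, NNReal.coe_div, coe_nnnorm, Real.norm_eq_abs, sub_neg_eq_add, this,
    NNReal.coe_ofNat]
  ring_nf

theorem lintegral_exp_box_le {f : Obs d → ℝ} (hf : Measurable f) {B t : ℝ} (hB0 : 0 < B)
    (hB : ∀ z, |f z| ≤ B) (x : Cov d) (r : ℝ) :
    ∫⁻ z, ENNReal.ofReal (Real.exp (boxKernel r x z.2.1 *
        (t / B ^ 2 * (f z - M.condMean f z.2.1) - t / B ^ 2 * t))) ∂M.law ≤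
      ENNReal.ofReal (Real.exp (-(M.covLaw.real (Metric.closedBall x r) *
        (1 - Real.exp (-(t ^ 2 / (2 * B ^ 2))))))) := by
  have hm := M.measurable_condMean' hf
  have hbox : Measurable fun x' : Cov d => boxKernel r x x' :=
    measurable_boxKernel_comp r measurable_const measurable_id
  set v := Real.exp (-(t ^ 2 / (2 * B ^ 2))) with hv
  have hv1 : v ≤ 1 := Real.exp_le_one_iff.2 (neg_nonpos.2 (by positivity))
  have hv0 : 0 < v := Real.exp_pos _
  rw [M.lintegral_law (by fun_prop)]
  have key : ∀ x', ∫⁻ z, ENNReal.ofReal (Real.exp (boxKernel r x z.2.1 *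
        (t / B ^ 2 * (f z - M.condMean f z.2.1) - t / B ^ 2 * t))) ∂M.condLaw x' ≤
      ENNReal.ofReal ((Metric.closedBall x r).indicator (fun _ => v - 1) x' + 1) := by
    intro x'
    have e1 : ∫⁻ z, ENNReal.ofReal (Real.exp (boxKernel r x z.2.1 *
        (t / B ^ 2 * (f z - M.condMean f z.2.1) - t / B ^ 2 * t))) ∂M.condLaw x' =
        ∫⁻ z, ENNReal.ofReal (Real.exp (boxKernel r x x' *
        (t / B ^ 2 * (f z - M.condMean f x') - t / B ^ 2 * t))) ∂M.condLaw x' := by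
      rw [M.lintegral_condLaw (by fun_prop), M.lintegral_condLaw (by fun_prop)]
    rw [e1]
    by_cases hx : x' ∈ Metric.closedBall x r
    · have : boxKernel r x x' = 1 := by
        rw [boxKernel, if_pos]
        rwa [Metric.mem_closedBall', dist_eq_norm] at hx
      simp only [this, one_mul, sub_eq_add_neg, Real.exp_add]
      simp_rw [ENNReal.ofReal_mul (Real.exp_pos _).le]
      rw [lintegral_mul_const _ (by fun_prop)]
      refine (mul_le_mul_left (M.lintegral_exp_condLaw_le hf hB x' (t / B ^ 2)) _).trans ?_
      rw [← ENNReal.ofReal_mul (Real.exp_pos _).le, ← Real.exp_add, Set.indicator_of_mem hx]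
      apply ENNReal.ofReal_le_ofReal
      rw [neg_add_cancel_right, hv]
      apply (congrArg Real.exp _).le
      field_simp
      ring
    · have : boxKernel r x x' = 0 := by
        rw [boxKernel, if_neg]
        rwa [Metric.mem_closedBall', dist_eq_norm] at hx
      simp [this, Set.indicator_of_notMem hx]
  refine (lintegral_mono key).trans ?_
  have hint : Integrable ((Metric.closedBall x r).indicator (fun _ => v - 1)) M.covLaw :=
    (integrable_const _).indicator Metric.isClosed_closedBall.measurableSet
  have hint' : Integrable (fun x' => (Metric.closedBall x r).indicator (fun _ => v - 1) x' + 1)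
      M.covLaw := hint.add (integrable_const _)
  rw [← ofReal_integral_eq_lintegral_ofReal hint' (ae_of_all _ fun x' => by
      by_cases hx : x' ∈ Metric.closedBall x r <;> simp [hx, hv0.le])]
  apply ENNReal.ofReal_le_ofReal
  rw [integral_add hint (integrable_const _),
    integral_indicator_const _ Metric.isClosed_closedBall.measurableSet]
  simp only [smul_eq_mul, integral_const, probReal_univ, mul_one]
  have := Real.add_one_le_exp (-(M.covLaw.real (Metric.closedBall x r) * (1 - v)))
  linarith

/-- One-sided deviation of a local average from the average of the conditional means. The event
contains the samples without a point in the box. -/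
theorem pi_box_sum_ge_le {n : ℕ} {f : Obs d → ℝ} (hf : Measurable f) {B t : ℝ} (hB0 : 0 < B)
    (ht : 0 ≤ t) (hB : ∀ z, |f z| ≤ B) (x : Cov d) (r : ℝ) :
    Measure.pi (fun _ : Fin n => M.law)
      {D : Fin n → Obs d | t * ∑ j, boxKernel r x (D j).2.1 ≤
        ∑ j, boxKernel r x (D j).2.1 * (f (D j) - M.condMean f (D j).2.1)} ≤
      ENNReal.ofReal (Real.exp (-(n * M.covLaw.real (Metric.closedBall x r) *
        (1 - Real.exp (-(t ^ 2 / (2 * B ^ 2))))))) := by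
  have hm := M.measurable_condMean' hf
  have hbox : Measurable fun x' : Cov d => boxKernel r x x' :=
    measurable_boxKernel_comp r measurable_const measurable_id
  set G : Obs d → ENNReal := fun z => ENNReal.ofReal (Real.exp (boxKernel r x z.2.1 *
        (t / B ^ 2 * (f z - M.condMean f z.2.1) - t / B ^ 2 * t))) with hG
  have hGm : Measurable G := by fun_prop
  have hle : ∫⁻ D, ∏ j, G (D j) ∂(Measure.pi fun _ : Fin n => M.law) ≤
      ENNReal.ofReal (Real.exp (-(n * M.covLaw.real (Metric.closedBall x r) *
        (1 - Real.exp (-(t ^ 2 / (2 * B ^ 2))))))) := by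
    rw [lintegral_pi_prod_eq_pow hGm]
    have h1 := M.lintegral_exp_box_le (t := t) hf hB0 hB x r
    have h2 : (∫⁻ z, G z ∂M.law) ^ n ≤ _ := ENNReal.pow_le_pow_left h1
    refine h2.trans_eq ?_
    rw [← ENNReal.ofReal_pow (Real.exp_pos _).le, ← Real.exp_nat_mul]
    congr 2
    ring
  have hmk := meas_ge_le_lintegral_div (μ := Measure.pi fun _ : Fin n => M.law)
    (f := fun D : Fin n → Obs d => ∏ j, G (D j)) (ε := 1)
    (Finset.measurable_prod _ fun j _ => hGm.comp (measurable_pi_apply j)).aemeasurable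
    one_ne_zero ENNReal.one_ne_top
  rw [div_one] at hmk
  have hsub : {D : Fin n → Obs d | t * ∑ j, boxKernel r x (D j).2.1 ≤
      ∑ j, boxKernel r x (D j).2.1 * (f (D j) - M.condMean f (D j).2.1)} ⊆
      {D | 1 ≤ ∏ j, G (D j)} := ?_
  · have h1 := measure_mono (μ := Measure.pi fun _ : Fin n => M.law) hsub
    exact h1.trans (hmk.trans hle)
  intro D hD
  simp only [Set.mem_ofPred_eq] at hD ⊢
  rw [hG, ← ENNReal.ofReal_prod_of_nonneg (fun _ _ => (Real.exp_pos _).le), ← Real.exp_sum,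
    ENNReal.one_le_ofReal, Real.one_le_exp_iff]
  have : ∑ j, boxKernel r x (D j).2.1 *
      (t / B ^ 2 * (f (D j) - M.condMean f (D j).2.1) - t / B ^ 2 * t) =
      t / B ^ 2 * (∑ j, boxKernel r x (D j).2.1 * (f (D j) - M.condMean f (D j).2.1) -
        t * ∑ j, boxKernel r x (D j).2.1) := by
    rw [Finset.mul_sum, ← Finset.sum_sub_distrib, Finset.mul_sum]
    exact Finset.sum_congr rfl fun j _ => by ring
  rw [this]
  exact mul_nonneg (by positivity) (sub_nonneg.2 hD)

theorem condMean_neg (f : Obs d → ℝ) (x : Cov d) :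
    M.condMean (fun z => -f z) x = -M.condMean f x := by
  simp only [condMean, integral_neg]
  ring

theorem pi_abs_box_sum_ge_le {n : ℕ} {f : Obs d → ℝ} (hf : Measurable f) {B t : ℝ} (hB0 : 0 < B)
    (ht : 0 ≤ t) (hB : ∀ z, |f z| ≤ B) (x : Cov d) (r : ℝ) :
    Measure.pi (fun _ : Fin n => M.law)
      {D : Fin n → Obs d | t * ∑ j, boxKernel r x (D j).2.1 ≤
        |∑ j, boxKernel r x (D j).2.1 * (f (D j) - M.condMean f (D j).2.1)|} ≤
      2 * ENNReal.ofReal (Real.exp (-(n * M.covLaw.real (Metric.closedBall x r) *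
        (1 - Real.exp (-(t ^ 2 / (2 * B ^ 2))))))) := by
  rw [two_mul]
  refine (measure_mono ?_).trans ((measure_union_le _ _).trans (add_le_add
    (M.pi_box_sum_ge_le (n := n) hf hB0 ht hB x r)
    (M.pi_box_sum_ge_le (n := n) (f := fun z => -f z) hf.neg hB0 ht (by simpa using hB) x r)))
  intro D hD
  rcases le_abs.1 (Set.mem_ofPred_eq ▸ hD) with h | h
  · exact Or.inl h
  · refine Or.inr (h.trans_eq ?_)
    rw [← Finset.sum_neg_distrib]
    exact Finset.sum_congr rfl fun j _ => by rw [M.condMean_neg]; ring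

end CausalModel

/-- The two halves of an i.i.d. sample are independent samples. -/
theorem map_splits_eq {d : ℕ} {Ω : Type*} [MeasurableSpace Ω] {P : Measure Ω}
    [IsProbabilityMeasure P] {Z : ℕ → Ω → Obs d} {ν : Measure (Obs d)} [IsProbabilityMeasure ν]
    (hZ : ∀ i, Measurable (Z i)) (hind : iIndepFun Z P) (hlaw : ∀ i, P.map (Z i) = ν) (n : ℕ) :
    P.map (fun ω => (firstSplit Z n ω, secondSplit Z n ω)) =
      (Measure.pi fun _ : Fin n => ν).prod (Measure.pi fun _ : Fin n => ν) := by
  let e : Fin n ⊕ Fin n → ℕ := Sum.elim (fun i => (i : ℕ)) (fun i => n + i)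
  have he : Function.Injective e := by
    rintro (i | i) (j | j) h <;> simp only [e, Sum.elim_inl, Sum.elim_inr] at h
    · rw [Fin.ext h]
    · omega
    · omega
    · rw [Fin.ext (Nat.add_left_cancel h)]
  have h := (iIndepFun_iff_map_fun_eq_pi_map (fun s => (hZ (e s)).aemeasurable)).1
    (hind.precomp he)
  simp only [hlaw] at h
  have hmp := (measurePreserving_sumPiEquivProdPi (fun _ : Fin n ⊕ Fin n => ν)).map_eq
  rw [← h, Measure.map_map (by fun_prop) (by fun_prop)] at hmp
  exact hmp

/-- A deviation bound conditional on the first half of the sample. -/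
theorem measure_splits_le {d : ℕ} {Ω : Type*} [MeasurableSpace Ω] {P : Measure Ω}
    [IsProbabilityMeasure P] {Z : ℕ → Ω → Obs d} {M : CausalModel d}
    (hZ : ∀ i, Measurable (Z i)) (hind : iIndepFun Z P) (hlaw : ∀ i, P.map (Z i) = M.law) {n : ℕ}
    {f : (Fin n → Obs d) × Obs d → ℝ} (hf : Measurable f) {B t : ℝ} (hB0 : 0 < B)
    (ht : 0 ≤ t) (hB : ∀ q, |f q| ≤ B) (x : Cov d) (r : ℝ) :
    P {ω | t * ∑ j, boxKernel r x (secondSplit Z n ω j).2.1 ≤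
        |∑ j, boxKernel r x (secondSplit Z n ω j).2.1 * (f (firstSplit Z n ω, secondSplit Z n ω j) -
          M.condMean (fun z => f (firstSplit Z n ω, z)) (secondSplit Z n ω j).2.1)|} ≤
      2 * ENNReal.ofReal (Real.exp (-(n * M.covLaw.real (Metric.closedBall x r) *
        (1 - Real.exp (-(t ^ 2 / (2 * B ^ 2))))))) := by
  have hm := M.measurable_condMean hf
  have hbox : Measurable fun x' : Cov d => boxKernel r x x' :=
    measurable_boxKernel_comp r measurable_const measurable_id
  let E : Set ((Fin n → Obs d) × (Fin n → Obs d)) :=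
    {q | t * ∑ j, boxKernel r x (q.2 j).2.1 ≤
        |∑ j, boxKernel r x (q.2 j).2.1 * (f (q.1, q.2 j) -
          M.condMean (fun z => f (q.1, z)) (q.2 j).2.1)|}
  have hX : ∀ j, Measurable fun q : (Fin n → Obs d) × (Fin n → Obs d) =>
      boxKernel r x (q.2 j).2.1 := fun j =>
    hbox.comp ((measurable_pi_apply j).comp measurable_snd).snd.fst
  have hm' : ∀ j, Measurable fun q : (Fin n → Obs d) × (Fin n → Obs d) =>
      M.condMean (fun z => f (q.1, z)) (q.2 j).2.1 := fun j =>
    hm.comp (measurable_fst.prodMk ((measurable_pi_apply j).comp measurable_snd).snd.fst)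
  have hf' : ∀ j, Measurable fun q : (Fin n → Obs d) × (Fin n → Obs d) => f (q.1, q.2 j) :=
    fun j => hf.comp (measurable_fst.prodMk ((measurable_pi_apply j).comp measurable_snd))
  have hE : MeasurableSet E := measurableSet_le
    ((Finset.measurable_sum _ fun j _ => hX j).const_mul t)
    (Finset.measurable_sum _ fun j _ => (hX j).mul ((hf' j).sub (hm' j))).abs
  have hs : Measurable fun ω => (firstSplit Z n ω, secondSplit Z n ω) := by
    exact (measurable_pi_lambda _ fun i => hZ _).prodMk (measurable_pi_lambda _ fun i => hZ _)
  change P ((fun ω => (firstSplit Z n ω, secondSplit Z n ω)) ⁻¹' E) ≤ _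
  rw [← Measure.map_apply hs hE, map_splits_eq hZ hind hlaw, Measure.prod_apply hE]
  calc _ ≤ ∫⁻ _ : Fin n → Obs d, _ ∂(Measure.pi fun _ : Fin n => M.law) :=
        lintegral_mono fun D => M.pi_abs_box_sum_ge_le (n := n) (f := fun z => f (D, z))
          (by fun_prop) hB0 ht (fun z => hB _) x r
    _ = _ := by simp

section Cdf

variable {ν : Measure ℝ} [IsProbabilityMeasure ν]

theorem measureReal_Iic_mono : Monotone fun y => ν.real (Set.Iic y) :=
  fun _ _ h => measureReal_mono (Set.Iic_subset_Iic.2 h)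

theorem measureReal_Ioc {c e : ℝ} (h : c ≤ e) :
    ν.real (Set.Ioc c e) = ν.real (Set.Iic e) - ν.real (Set.Iic c) := by
  rw [← Set.Iic_sdiff_Iic, measureReal_sdiff (Set.Iic_subset_Iic.2 h) measurableSet_Iic]

theorem continuous_measureReal_Iic [NullSingletonClass ν]:
    Continuous fun y => ν.real (Set.Iic y) := by
  have h : (fun y => ν.real (Set.Iic y)) = cdf ν := by
    ext y
    rw [cdf_eq_real]
  rw [h, continuous_iff_continuousAt]
  intro y
  rw [(monotone_cdf ν).continuousAt_iff_leftLim_eq_rightLim, (cdf ν).rightLim_eq]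
  have h1 := (cdf ν).measure_singleton y
  rw [measure_cdf, measure_singleton, eq_comm, ENNReal.ofReal_eq_zero] at h1
  exact le_antisymm ((monotone_cdf ν).leftLim_le le_rfl) (by linarith)

/-- The values of a continuous cdf at points of a set of full measure are dense in `[0, 1]`. -/
theorem exists_mem_cdf_mem_Ioo [NullSingletonClass ν] {s : Set ℝ} (hs : ν sᶜ = 0) {a b : ℝ}
    (ha : 0 ≤ a) (hab : a < b) (hb : b ≤ 1) : ∃ y ∈ s, ν.real (Set.Iic y) ∈ Set.Ioo a b := by
  have hc := continuous_measureReal_Iic (ν := ν)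
  have hrange : ∀ v ∈ Set.Ioo (0 : ℝ) 1, ∃ y, ν.real (Set.Iic y) = v := by
    intro v hv
    have h0 := tendsto_cdf_atBot ν
    have h1 := tendsto_cdf_atTop ν
    obtain ⟨y0, hy0⟩ := (h0.eventually_lt_const hv.1).exists
    obtain ⟨y1, hy1⟩ := (h1.eventually_const_lt hv.2).exists
    rw [cdf_eq_real] at hy0 hy1
    exact mem_range_of_exists_le_of_exists_ge hc ⟨y0, hy0.le⟩ ⟨y1, hy1.le⟩
  obtain ⟨c, hc1⟩ := hrange (a + (b - a) / 3) ⟨by linarith, by linarith⟩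
  obtain ⟨e, he1⟩ := hrange (a + 2 * (b - a) / 3) ⟨by linarith, by linarith⟩
  have hce : c ≤ e := by
    by_contra! hlt
    have := measureReal_Iic_mono (ν := ν) hlt.le
    simp only at this
    linarith
  have hpos : 0 < ν.real (Set.Ioc c e) := by
    rw [measureReal_Ioc hce]
    linarith
  have hne : (Set.Ioc c e ∩ s).Nonempty := by
    by_contra hemp
    rw [Set.not_nonempty_iff_eq_empty] at hemp
    have hsub : Set.Ioc c e ⊆ sᶜ := fun y hy hys => by
      have : y ∈ Set.Ioc c e ∩ s := ⟨hy, hys⟩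
      simp [hemp] at this
    have h0 : ν (Set.Ioc c e) = 0 := measure_mono_null hsub hs
    simp [measureReal_def, h0] at hpos
  obtain ⟨y, hy, hys⟩ := hne
  have h1 := measureReal_Iic_mono (ν := ν) hy.1.le
  have h2 := measureReal_Iic_mono (ν := ν) hy.2
  simp only at h1 h2
  exact ⟨y, hys, by linarith, by linarith⟩

/-- A grid of `m` points of a set of full measure which brackets every point up to probability
`2 / m`. -/
theorem exists_bracketing [NullSingletonClass ν] {s : Set ℝ} (hs : ν sᶜ = 0) {m : ℕ} (hm : 0 < m) :
    ∃ b : Fin m → ℝ, (∀ k, b k ∈ s) ∧ ∀ y,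
      ((∃ k, y ≤ b k ∧ ν.real (Set.Iic (b k)) ≤ ν.real (Set.Iic y) + 2 / m) ∨
        1 ≤ ν.real (Set.Iic y) + 2 / m) ∧
      ((∃ k, b k ≤ y ∧ ν.real (Set.Iic y) ≤ ν.real (Set.Iic (b k)) + 2 / m) ∨
        ν.real (Set.Iic y) ≤ 2 / m) := by
  have hm' : (0 : ℝ) < m := Nat.cast_pos.2 hm
  have hex : ∀ k : Fin m, ∃ y ∈ s,
      ν.real (Set.Iic y) ∈ Set.Ioo ((k : ℝ) / m) (((k : ℝ) + 1) / m) := by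
    intro k
    refine exists_mem_cdf_mem_Ioo hs (by positivity) (by gcongr; linarith) ?_
    rw [div_le_one hm']
    exact_mod_cast k.2
  choose b hbs hb using hex
  refine ⟨b, hbs, fun y => ?_⟩
  set v := ν.real (Set.Iic y) with hv
  have hv0 : 0 ≤ v := measureReal_nonneg
  have hvm : 0 ≤ v * m := by positivity
  have hlt : ∀ {y z : ℝ}, ν.real (Set.Iic y) < ν.real (Set.Iic z) → y ≤ z := fun {y z} h => by
    by_contra! hzy
    have := measureReal_Iic_mono (ν := ν) hzy.le
    simp only at this
    linarith
  constructor
  · by_cases h : 1 ≤ v + 2 / m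
    · exact Or.inr h
    · refine Or.inl ?_
      push Not at h
      have h' : v * m + 2 < m := by
        have := mul_lt_mul_of_pos_right h hm'
        rwa [add_mul, div_mul_cancel₀ _ hm'.ne', one_mul] at this
      have hfl := Nat.floor_le hvm
      have hfl2 := Nat.lt_floor_add_one (v * m)
      have hk : ⌊v * m⌋₊ + 1 < m := by
        have : (⌊v * m⌋₊ : ℝ) + 1 < m := by linarith
        exact_mod_cast this
      obtain ⟨h1, h2⟩ := hb ⟨⌊v * m⌋₊ + 1, hk⟩
      push_cast at h1 h2
      refine ⟨⟨⌊v * m⌋₊ + 1, hk⟩, hlt (lt_trans ?_ h1), h2.le.trans ?_⟩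
      · rw [lt_div_iff₀ hm']
        exact hfl2
      · rw [← sub_nonneg]
        have : v + 2 / m - ((⌊v * m⌋₊ : ℝ) + 1 + 1) / m = (v * m - ⌊v * m⌋₊) / m := by
          field_simp
          ring
        rw [this]
        exact div_nonneg (sub_nonneg.2 hfl) hm'.le
  · by_cases h : v ≤ 2 / m
    · exact Or.inr h
    · refine Or.inl ?_
      push Not at h
      have h' : 2 < v * m := by rwa [div_lt_iff₀ hm'] at h
      have hce := Nat.le_ceil (v * m)
      have hce2 := Nat.ceil_lt_add_one hvm
      have h2le : 3 ≤ ⌈v * m⌉₊ := by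
        have : (2 : ℝ) < ⌈v * m⌉₊ := by linarith
        exact_mod_cast this
      obtain ⟨k, hk⟩ := Nat.exists_eq_add_of_le h2le
      have hkr : (⌈v * m⌉₊ : ℝ) = 3 + k := by rw [hk]; push_cast; ring
      have hv1 : v ≤ 1 := measureReal_le_one
      have hkm : k + 1 < m := by
        have : (k : ℝ) + 1 < m := by nlinarith
        exact_mod_cast this
      obtain ⟨h1, h2⟩ := hb ⟨k + 1, hkm⟩
      push_cast at h1 h2
      refine ⟨⟨k + 1, hkm⟩, hlt (h2.trans ?_), ?_⟩
      · rw [← hv, div_lt_iff₀ hm']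
        linarith
      · have : v ≤ ((k : ℝ) + 1) / m + 2 / m := by
          rw [← add_div, le_div_iff₀ hm']
          linarith
        linarith

/-- A lower bound of the density bounds increments of the cdf from below. -/
theorem mul_sub_le_measureReal_Iic_sub {η c e : ℝ} (hη : 0 ≤ η) (hce : c ≤ e)
    (h : ∀ᵐ y ∂volume, y ∈ Set.Ioo c e → ENNReal.ofReal η ≤ ν.rnDeriv volume y) :
    η * (e - c) ≤ ν.real (Set.Iic e) - ν.real (Set.Iic c) := by
  rw [← measureReal_Ioc hce]
  have h1 : ∫⁻ y in Set.Ioo c e, ENNReal.ofReal η ≤ ν (Set.Ioo c e) :=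
    (setLIntegral_mono_ae' measurableSet_Ioo h).trans (Measure.setLIntegral_rnDeriv_le _)
  rw [setLIntegral_const, Real.volume_Ioo, ← ENNReal.ofReal_mul hη] at h1
  have h2 := h1.trans (measure_mono Set.Ioo_subset_Ioc_self)
  rw [measureReal_def]
  exact (ENNReal.ofReal_le_iff_le_toReal (measure_ne_top _ _)).1 h2

end Cdf

section Isotonic

variable {p : ℕ}

theorem IsIsotonicProj.le_of_le {u v m : Fin p → ℝ} (h : IsIsotonicProj u v) (hm : Monotone m)
    (hum : ∀ l, u l ≤ m l) (l : Fin p) : v l ≤ m l := by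
  by_contra! hl
  have hw : Monotone fun l => min (v l) (m l) := fun i j hij => min_le_min (h.1 hij) (hm hij)
  refine absurd (h.2 _ hw) (not_le.2 (Finset.sum_lt_sum (fun i _ => ?_) ⟨l, Finset.mem_univ l, ?_⟩))
  · rcases le_total (v i) (m i) with hi | hi
    · rw [min_eq_left hi]
    · rw [min_eq_right hi]
      nlinarith [hum i]
  · rw [min_eq_right hl.le]
    nlinarith [hum l]

theorem IsIsotonicProj.le_of_ge {u v m : Fin p → ℝ} (h : IsIsotonicProj u v) (hm : Monotone m)
    (hum : ∀ l, m l ≤ u l) (l : Fin p) : m l ≤ v l := by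
  by_contra! hl
  have hw : Monotone fun l => max (v l) (m l) := fun i j hij => max_le_max (h.1 hij) (hm hij)
  refine absurd (h.2 _ hw) (not_le.2 (Finset.sum_lt_sum (fun i _ => ?_) ⟨l, Finset.mem_univ l, ?_⟩))
  · rcases le_total (m i) (v i) with hi | hi
    · rw [max_eq_left hi]
    · rw [max_eq_right hi]
      nlinarith [hum i]
  · rw [max_eq_right hl.le]
    nlinarith [hum l]

/-- The isotonic projection does not increase the uniform distance to a monotone vector. -/
theorem abs_isotonicProj_sub_le {u m : Fin p → ℝ} (hm : Monotone m) {ε : ℝ}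
    (h : ∀ l, |u l - m l| ≤ ε) (l : Fin p) : |isotonicProj u l - m l| ≤ ε := by
  have hu : IsIsotonicProj u (isotonicProj u) := (exists_isIsotonicProj u).choose_spec
  have h1 := hu.le_of_le (m := fun l => m l + ε) (fun i j hij => by simpa using hm hij)
    (fun l => by linarith [(abs_le.1 (h l)).2]) l
  have h2 := hu.le_of_ge (m := fun l => m l - ε) (fun i j hij => by simpa using hm hij)
    (fun l => by linarith [(abs_le.1 (h l)).1]) l
  exact abs_le.2 ⟨by linarith, by linarith⟩

end Isotonic

namespace NWAssumptions

variable {d : ℕ} {M : CausalModel d} {𝒳 : Set (Cov d)} {𝒴 : Set ℝ} {x : Cov d} {Ω : Type*}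
  [MeasurableSpace Ω] {P : Measure Ω} {Z : ℕ → Ω → Obs d}
  {piHat : (n : ℕ) → (Fin n → Obs d) → Cov d → ℝ} {α β γ ξ C Cα Cβ C₀ C₂ : ℝ}

theorem noAtoms (h : NWAssumptions M 𝒳 𝒴 x P Z piHat α β γ ξ C Cα Cβ C₀ C₂) (a : Bool)
    {x' : Cov d} (hx' : x' ∈ 𝒳) : NullSingletonClass (M.outcome a x') :=
  ⟨fun _ => h.outcome_ac a x' hx' Real.volume_singleton⟩

theorem exists_ccdf_gt (h : NWAssumptions M 𝒳 𝒴 x P Z piHat α β γ ξ C Cα Cβ C₀ C₂) (a : Bool)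
    {x' x'' : Cov d} (hx' : x' ∈ 𝒳) (hx'' : x'' ∈ 𝒳) {ε : ℝ} (hε : 0 < ε) :
    ∃ y ∈ 𝒴, 1 - ε < M.ccdf a y x' ∧ 1 - ε < M.ccdf a y x'' := by
  have key : ∀ u ∈ 𝒳, ∃ y ∈ 𝒴, 1 - ε < M.ccdf a y u := fun u hu => by
    have := h.noAtoms a hu
    obtain ⟨y, hy, hy'⟩ := exists_mem_cdf_mem_Ioo (h.outcome_compl a u hu)
      (a := max 0 (1 - ε)) (b := 1) (le_max_left _ _) (by simp [hε]) le_rfl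
    exact ⟨y, hy, (le_max_right _ _).trans_lt hy'.1⟩
  obtain ⟨y', hy', h'⟩ := key x' hx'
  obtain ⟨y'', hy'', h''⟩ := key x'' hx''
  rcases le_total y' y'' with hle | hle
  · exact ⟨y'', hy'', h'.trans_le (measureReal_Iic_mono hle), h''⟩
  · exact ⟨y', hy', h', h''.trans_le (measureReal_Iic_mono hle)⟩

/-- The Hölder condition on the contrasting function passes to both conditional CDFs. -/
theorem abs_ccdf_sub_le (h : NWAssumptions M 𝒳 𝒴 x P Z piHat α β γ ξ C Cα Cβ C₀ C₂) (a : Bool)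
    {y : ℝ} (hy : y ∈ 𝒴) {x' x'' : Cov d} (hx' : x' ∈ 𝒳) (hx'' : x'' ∈ 𝒳) :
    |M.ccdf a y x' - M.ccdf a y x''| ≤ C * ‖x' - x''‖ ^ γ := by
  refine le_of_forall_pos_le_add fun ε hε => ?_
  obtain ⟨y', hy', h1, h2⟩ := h.exists_ccdf_gt (!a) hx' hx'' hε
  have h3 : M.ccdf (!a) y' x' ≤ 1 := measureReal_le_one
  have h4 : M.ccdf (!a) y' x'' ≤ 1 := measureReal_le_one
  cases a
  · have := abs_le.1 (h.holder y hy y' hy' x' hx' x'' hx'')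
    simp only [CausalModel.contrast, Bool.not_false] at *
    exact abs_le.2 ⟨by linarith, by linarith⟩
  · have := abs_le.1 (h.holder y' hy' y hy x' hx' x'' hx'')
    simp only [CausalModel.contrast, Bool.not_true] at *
    exact abs_le.2 ⟨by linarith, by linarith⟩

end NWAssumptions

section Arms

variable {d n : ℕ}

/-- The probability of treatment `a` if that of treatment `true` is `p`. -/
def armProb (a : Bool) (p : ℝ) : ℝ := if a then p else 1 - p

theorem armProb_mem {a : Bool} {p ξ : ℝ} (hp : p ∈ Set.Icc ξ (1 - ξ)) :
    armProb a p ∈ Set.Icc ξ (1 - ξ) := by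
  cases a
  · simp only [armProb, Bool.false_eq_true, if_false]
    exact ⟨by linarith [hp.2], by linarith [hp.1]⟩
  · simpa [armProb] using hp

theorem abs_armProb_sub (a : Bool) (p q : ℝ) : |armProb a p - armProb a q| = |q - p| := by
  cases a
  · simp [armProb]
  · simp [armProb, abs_sub_comm]

/-- The inverse probability weight of an observation for arm `a`. -/
noncomputable def ipw (a : Bool) (p : Cov d → ℝ) (z : Obs d) : ℝ :=
  (if z.2.2 = a then 1 else 0) / armProb a (p z.2.1)

theorem ipw_mem {a : Bool} {p : Cov d → ℝ} {z : Obs d} {ξ : ℝ} (hξ : 0 < ξ)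
    (hp : p z.2.1 ∈ Set.Icc ξ (1 - ξ)) : ipw a p z ∈ Set.Icc 0 (1 / ξ) := by
  have h := (armProb_mem (a := a) hp).1
  unfold ipw
  split_ifs
  · exact ⟨by positivity [hξ.trans_le h], one_div_le_one_div_of_le hξ h⟩
  · simpa using hξ.le

/-- The doubly robust pseudo-outcome for the conditional CDF of arm `a`. -/
noncomputable def armOutcome (p : Cov d → ℝ) (F : ℝ → Cov d → ℝ) (a : Bool) (y : ℝ) (z : Obs d) :
    ℝ :=
  ipw a p z * (if z.1 ≤ y then 1 else 0) + (1 - ipw a p z) * F y z.2.1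

theorem pseudoOutcome_eq_sub {p : Cov d → ℝ} (F : Bool → ℝ → Cov d → ℝ) (y₀ y₁ : ℝ) {z : Obs d}
    (h0 : p z.2.1 ≠ 0) (h1 : 1 - p z.2.1 ≠ 0) :
    pseudoOutcome p F y₀ y₁ z =
      armOutcome p (F true) true y₁ z - armOutcome p (F false) false y₀ z := by
  obtain ⟨y, x, a⟩ := z
  simp only at h0 h1
  cases a <;> simp only [pseudoOutcome, armOutcome, ipw, armProb, Bool.false_eq_true, if_false,
    if_true, Bool.true_eq_false] <;> field_simp <;> ring

/-- The doubly robust estimate of the conditional CDF of arm `a`. -/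
noncomputable def armHat (rh rF : ℝ) (p : Cov d → ℝ) (D₁ D₂ : Fin n → Obs d) (a : Bool) (y : ℝ)
    (x : Cov d) : ℝ :=
  ∑ j, nwWeight rh x (fun i => (D₂ i).2.1) j * armOutcome p (ccdfHat rF D₁ a) a y (D₂ j)

theorem contrastHat_eq_sub (rh rF : ℝ) {p : Cov d → ℝ} (D₁ D₂ : Fin n → Obs d) (y₀ y₁ : ℝ)
    (x : Cov d) (hp : ∀ j, p (D₂ j).2.1 ∈ Set.Ioo (0 : ℝ) 1) :
    contrastHat rh rF p D₁ D₂ y₀ y₁ x =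
      armHat rh rF p D₁ D₂ true y₁ x - armHat rh rF p D₁ D₂ false y₀ x := by
  rw [contrastHat, armHat, armHat, ← Finset.sum_sub_distrib]
  refine Finset.sum_congr rfl fun j _ => ?_
  rw [pseudoOutcome_eq_sub _ _ _ (hp j).1.ne' (sub_pos.2 (hp j).2).ne', mul_sub]

theorem contrastHat_congr (rh rF : ℝ) {p q : Cov d → ℝ} (D₁ D₂ : Fin n → Obs d) (y₀ y₁ : ℝ)
    (x : Cov d) (hpq : ∀ j, p (D₂ j).2.1 = q (D₂ j).2.1) :
    contrastHat rh rF p D₁ D₂ y₀ y₁ x = contrastHat rh rF q D₁ D₂ y₀ y₁ x := by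
  refine Finset.sum_congr rfl fun j _ => ?_
  simp only [pseudoOutcome, hpq j]

theorem boxKernel_nonneg (r : ℝ) (x x' : Cov d) : 0 ≤ boxKernel r x x' := by
  unfold boxKernel
  split_ifs <;> norm_num

theorem nwWeight_nonneg (r : ℝ) (x : Cov d) (X : Fin n → Cov d) (j : Fin n) :
    0 ≤ nwWeight r x X j :=
  div_nonneg (boxKernel_nonneg _ _ _) (Finset.sum_nonneg fun _ _ => boxKernel_nonneg _ _ _)

theorem norm_sub_le_of_nwWeight_pos {r : ℝ} {x : Cov d} {X : Fin n → Cov d} {j : Fin n}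
    (h : 0 < nwWeight r x X j) : ‖x - X j‖ ≤ r := by
  by_contra hn
  simp [nwWeight, boxKernel, hn] at h

theorem sum_nwWeight_le_one (r : ℝ) (x : Cov d) (X : Fin n → Cov d) :
    ∑ j, nwWeight r x X j ≤ 1 := by
  unfold nwWeight
  rw [← Finset.sum_div]
  exact div_self_le_one _

/-- A deviation of box sums bounds that of the weighted averages; the box is not empty. -/
theorem nwWeight_of_abs_box_sum_lt {r : ℝ} {x : Cov d} {X : Fin n → Cov d} {t : ℝ} (ht : 0 ≤ t)
    {φ : Fin n → ℝ} (h : |∑ j, boxKernel r x (X j) * φ j| < t * ∑ j, boxKernel r x (X j)) :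
    ∑ j, nwWeight r x X j = 1 ∧ |∑ j, nwWeight r x X j * φ j| ≤ t := by
  have hK : 0 < ∑ j, boxKernel r x (X j) := by
    by_contra! hK
    have := (abs_nonneg _).trans_lt h
    nlinarith
  constructor
  · unfold nwWeight
    rw [← Finset.sum_div, div_self hK.ne']
  · have : ∑ j, nwWeight r x X j * φ j =
        (∑ j, boxKernel r x (X j) * φ j) / ∑ j, boxKernel r x (X j) := by
      rw [Finset.sum_div]
      exact Finset.sum_congr rfl fun j _ => by rw [nwWeight]; ring
    rw [this, abs_div, abs_of_pos hK, div_le_iff₀ hK]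
    exact h.le

/-- The weights of the estimate of the conditional CDF. -/
noncomputable def ccdfWeight (r : ℝ) (D : Fin n → Obs d) (a : Bool) (x : Cov d) (i : Fin n) : ℝ :=
  (boxKernel r x (D i).2.1 * (if (D i).2.2 = a then 1 else 0)) /
    (∑ j, boxKernel r x (D j).2.1 * (if (D j).2.2 = a then 1 else 0))

theorem ccdfHat_eq_sum (r : ℝ) (D : Fin n → Obs d) (a : Bool) (y : ℝ) (x : Cov d) :
    ccdfHat r D a y x = ∑ i, ccdfWeight r D a x i * (if (D i).1 ≤ y then 1 else 0) := rfl

theorem ccdfWeight_nonneg (r : ℝ) (D : Fin n → Obs d) (a : Bool) (x : Cov d) (i : Fin n) :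
    0 ≤ ccdfWeight r D a x i := by
  have h : ∀ j, 0 ≤ boxKernel r x (D j).2.1 * (if (D j).2.2 = a then (1 : ℝ) else 0) := fun j =>
    mul_nonneg (boxKernel_nonneg _ _ _) (by split_ifs <;> norm_num)
  exact div_nonneg (h i) (Finset.sum_nonneg fun j _ => h j)

theorem ccdfHat_mono (r : ℝ) (D : Fin n → Obs d) (a : Bool) (x : Cov d) :
    Monotone fun y => ccdfHat r D a y x := fun y y' hy => by
  simp only [ccdfHat_eq_sum]
  refine Finset.sum_le_sum fun i _ => mul_le_mul_of_nonneg_left ?_ (ccdfWeight_nonneg _ _ _ _ _)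
  split_ifs with h1 h2 <;> first | exact absurd (h1.trans hy) h2 | norm_num

theorem ccdfHat_mem (r : ℝ) (D : Fin n → Obs d) (a : Bool) (y : ℝ) (x : Cov d) :
    ccdfHat r D a y x ∈ Set.Icc (0 : ℝ) 1 := by
  rw [ccdfHat_eq_sum]
  refine ⟨Finset.sum_nonneg fun i _ => mul_nonneg (ccdfWeight_nonneg _ _ _ _ _)
    (by split_ifs <;> norm_num), ?_⟩
  calc _ ≤ ∑ i, ccdfWeight r D a x i := Finset.sum_le_sum fun i _ =>
        mul_le_of_le_one_right (ccdfWeight_nonneg _ _ _ _ _) (by split_ifs <;> norm_num)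
    _ ≤ 1 := by
        unfold ccdfWeight
        rw [← Finset.sum_div]
        exact div_self_le_one _

/-- Each value of `y` gives the same estimate as a data point, or the estimate zero. -/
theorem ccdfHat_eq_or (r : ℝ) (D : Fin n → Obs d) (a : Bool) (y : ℝ) :
    (∀ x, ccdfHat r D a y x = 0) ∨ ∃ i, ∀ x, ccdfHat r D a y x = ccdfHat r D a (D i).1 x := by
  by_cases h : (Finset.univ.filter fun i => (D i).1 ≤ y).Nonempty
  · obtain ⟨i, hi, hmax⟩ := Finset.exists_max_image _ (fun i => (D i).1) h
    refine Or.inr ⟨i, fun x => ?_⟩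
    rw [ccdfHat_eq_sum, ccdfHat_eq_sum]
    refine Finset.sum_congr rfl fun l _ => ?_
    have : (D l).1 ≤ y ↔ (D l).1 ≤ (D i).1 :=
      ⟨fun hl => hmax l (by simpa using hl), fun hl => hl.trans (by simpa using hi)⟩
    simp only [this]
  · refine Or.inl fun x => ?_
    rw [ccdfHat_eq_sum]
    refine Finset.sum_eq_zero fun l _ => ?_
    rw [if_neg, mul_zero]
    intro hl
    exact h ⟨l, by simpa using hl⟩

theorem measurable_ccdfHat {α : Type*} [MeasurableSpace α] (r : ℝ) (a : Bool)
    {D : α → Fin n → Obs d} (hD : Measurable D) {y : α → ℝ} (hy : Measurable y) {x : α → Cov d}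
    (hx : Measurable x) : Measurable fun q => ccdfHat r (D q) a (y q) (x q) := by
  have hDi : ∀ i, Measurable fun q => D q i := fun i => (measurable_pi_apply i).comp hD
  have hk : ∀ i, Measurable fun q => boxKernel r (x q) (D q i).2.1 *
      (if (D q i).2.2 = a then (1 : ℝ) else 0) := fun i =>
    (measurable_boxKernel_comp r hx (hDi i).snd.fst).mul
      (Measurable.ite ((hDi i).snd.snd (measurableSet_singleton a)) (by fun_prop) (by fun_prop))
  unfold ccdfHat
  refine Finset.measurable_sum _ fun i _ =>
    ((hk i).div (Finset.measurable_sum _ fun j _ => hk j)).mul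
    (Measurable.ite (measurableSet_le (hDi i).fst hy) (by fun_prop) (by fun_prop))

theorem measurable_armProb {α : Type*} [MeasurableSpace α] (a : Bool) {p : α → ℝ}
    (hp : Measurable p) : Measurable fun q => armProb a (p q) := by
  cases a
  · simpa [armProb] using hp.const_sub 1
  · simpa [armProb] using hp

theorem abs_armHat_le (rh rF : ℝ) {p : Cov d → ℝ} (D₁ D₂ : Fin n → Obs d) (a : Bool) (y : ℝ)
    (x : Cov d) {ξ : ℝ} (hξ : ξ ∈ Set.Ioc (0 : ℝ) (1 / 2))
    (hp : ∀ j, p (D₂ j).2.1 ∈ Set.Icc ξ (1 - ξ)) : |armHat rh rF p D₁ D₂ a y x| ≤ 1 / ξ := by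
  have hξ1 : 1 ≤ 1 / ξ := by
    rw [le_div_iff₀ hξ.1]
    linarith [hξ.2]
  have hb : ∀ j, |armOutcome p (ccdfHat rF D₁ a) a y (D₂ j)| ≤ 1 / ξ := fun j => by
    have h1 := ipw_mem (a := a) hξ.1 (hp j)
    have h2 := ccdfHat_mem rF D₁ a y (D₂ j).2.1
    unfold armOutcome
    set s := ipw a p (D₂ j)
    set u := ccdfHat rF D₁ a y (D₂ j).2.1
    have h3 : s * u ≤ 1 / ξ := (mul_le_of_le_one_right h1.1 h2.2).trans h1.2
    have h4 : 0 ≤ s * u := mul_nonneg h1.1 h2.1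
    have h5 : s * (1 - u) ≤ 1 / ξ * (1 - u) := mul_le_mul_of_nonneg_right h1.2 (by linarith [h2.2])
    have h6 : (1 / ξ - 1) * (1 - u) ≤ 1 / ξ - 1 :=
      mul_le_of_le_one_right (by linarith) (by linarith [h2.1])
    split_ifs <;> refine abs_le.2 ⟨?_, ?_⟩ <;> nlinarith [h2.1, h2.2, h1.1, h1.2]
  refine (Finset.abs_sum_le_sum_abs _ _).trans ?_
  calc _ ≤ ∑ j, nwWeight rh x (fun i => (D₂ i).2.1) j * (1 / ξ) := Finset.sum_le_sum fun j _ => by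
        rw [abs_mul, abs_of_nonneg (nwWeight_nonneg _ _ _ _)]
        exact mul_le_mul_of_nonneg_left (hb j) (nwWeight_nonneg _ _ _ _)
    _ ≤ 1 / ξ := by
        rw [← Finset.sum_mul]
        exact mul_le_of_le_one_left (by linarith) (sum_nwWeight_le_one _ _ _)

end Arms

section WeightedSums

variable {ι : Type*} [Fintype ι] {w : ι → ℝ}

theorem sum_mul_le_sum_mul_of_pos (hw : ∀ j, 0 ≤ w j) {f g : ι → ℝ}
    (h : ∀ j, 0 < w j → f j ≤ g j) : ∑ j, w j * f j ≤ ∑ j, w j * g j :=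
  Finset.sum_le_sum fun j _ => by
    rcases (hw j).eq_or_lt with h0 | h0
    · simp [← h0]
    · exact mul_le_mul_of_nonneg_left (h j h0) h0.le

theorem sum_mul_abs_mul_abs_le (hw : ∀ j, 0 ≤ w j) (f g : ι → ℝ) :
    ∑ j, w j * (|f j| * |g j|) ≤ √(∑ j, w j * f j ^ 2) * √(∑ j, w j * g j ^ 2) := by
  have h := Real.sum_mul_le_sqrt_mul_sqrt Finset.univ (fun j => √(w j) * |f j|)
    (fun j => √(w j) * |g j|)
  have hs := fun j => Real.mul_self_sqrt (hw j)
  simp only [mul_pow, Real.sq_sqrt (hw _), sq_abs] at h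
  refine le_trans (le_of_eq (Finset.sum_congr rfl fun j _ => ?_)) h
  linear_combination (|f j| * |g j|) * -(hs j)

/-- The error of a doubly robust weighted average, by bracketing the indicators `I` with `Im` and
`Ip`. -/
theorem abs_sum_doublyRobust_sub_le (hw : ∀ j, 0 ≤ w j) (hw1 : ∑ j, w j = 1)
    {ρ θ I Im Ip F Fh Gm Gp em ep : ι → ℝ} {B t Δ b : ℝ} (hΔ : 0 ≤ Δ)
    (hρ : ∀ j, 0 ≤ ρ j) (hθ : ∀ j, 0 < w j → θ j ∈ Set.Icc 0 B) (hθ1 : ∀ j, 0 < w j → |1 - θ j| ≤ B)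
    (hQ : |∑ j, w j * ((1 - ρ j) * Fh j - (1 - θ j) * Fh j)| ≤ t)
    (hIp : ∀ j, I j ≤ Ip j) (hRp : |∑ j, w j * (ρ j * Ip j - θ j * Gp j)| ≤ t)
    (hGp : ∀ j, 0 < w j → Gp j ≤ F j + Δ) (hep : ∀ j, 0 < w j → Fh j ≤ F j + Δ + ep j)
    (hIm : ∀ j, Im j ≤ I j) (hRm : |∑ j, w j * (ρ j * Im j - θ j * Gm j)| ≤ t)
    (hGm : ∀ j, 0 < w j → F j - Δ ≤ Gm j) (hem : ∀ j, 0 < w j → F j - Δ - em j ≤ Fh j)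
    (hep0 : ∀ j, 0 ≤ ep j) (hem0 : ∀ j, 0 ≤ em j)
    (hbp : ∑ j, w j * (|1 - θ j| * ep j) ≤ b) (hbm : ∑ j, w j * (|1 - θ j| * em j) ≤ b) :
    |∑ j, w j * (ρ j * I j + (1 - ρ j) * Fh j) - ∑ j, w j * F j| ≤
      2 * t + 2 * (B * Δ) + 2 * b := by
  have e1 : ∑ j, w j * (ρ j * I j) ≤ ∑ j, w j * (ρ j * Ip j) :=
    sum_mul_le_sum_mul_of_pos hw fun j _ => mul_le_mul_of_nonneg_left (hIp j) (hρ j)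
  have e2 : ∑ j, w j * (ρ j * Im j) ≤ ∑ j, w j * (ρ j * I j) :=
    sum_mul_le_sum_mul_of_pos hw fun j _ => mul_le_mul_of_nonneg_left (hIm j) (hρ j)
  have hconst : ∀ c : ℝ, ∑ j, w j * c = c := fun c => by rw [← Finset.sum_mul, hw1, one_mul]
  have e3 : ∑ j, w j * (θ j * Gp j) ≤ ∑ j, w j * (θ j * F j + B * Δ) :=
    sum_mul_le_sum_mul_of_pos hw fun j hj => by
      have := hθ j hj
      nlinarith [mul_le_mul_of_nonneg_left (hGp j hj) this.1, mul_le_mul_of_nonneg_right this.2 hΔ]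
  have e4 : ∑ j, w j * (θ j * F j - B * Δ) ≤ ∑ j, w j * (θ j * Gm j) :=
    sum_mul_le_sum_mul_of_pos hw fun j hj => by
      have := hθ j hj
      nlinarith [mul_le_mul_of_nonneg_left (hGm j hj) this.1, mul_le_mul_of_nonneg_right this.2 hΔ]
  have habs : ∀ j, 0 < w j → |(1 - θ j) * (Fh j - F j)| ≤
      B * Δ + (|1 - θ j| * ep j + |1 - θ j| * em j) := fun j hj => by
    rw [abs_mul]
    have h1 : |Fh j - F j| ≤ Δ + (ep j + em j) :=
      abs_le.2 ⟨by linarith [hem j hj, hep0 j], by linarith [hep j hj, hem0 j]⟩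
    have h2 := mul_le_mul_of_nonneg_left h1 (abs_nonneg (1 - θ j))
    have h3 := mul_le_mul_of_nonneg_right (hθ1 j hj) hΔ
    linarith
  have e5 : ∑ j, w j * ((1 - θ j) * (Fh j - F j)) ≤
      ∑ j, w j * (B * Δ + (|1 - θ j| * ep j + |1 - θ j| * em j)) :=
    sum_mul_le_sum_mul_of_pos hw fun j hj => (abs_le.1 (habs j hj)).2
  have e6 : ∑ j, w j * -(B * Δ + (|1 - θ j| * ep j + |1 - θ j| * em j)) ≤
      ∑ j, w j * ((1 - θ j) * (Fh j - F j)) :=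
    sum_mul_le_sum_mul_of_pos hw fun j hj => (abs_le.1 (habs j hj)).1
  obtain ⟨q1, q2⟩ := abs_le.1 hQ
  obtain ⟨p1, p2⟩ := abs_le.1 hRp
  obtain ⟨m1, m2⟩ := abs_le.1 hRm
  simp only [mul_add, mul_sub, sub_mul, one_mul, mul_neg, Finset.sum_add_distrib,
    Finset.sum_sub_distrib, Finset.sum_neg_distrib, hconst] at *
  exact abs_le.2 ⟨by linarith, by linarith⟩

theorem CausalModel.condMean_comp_covariates {d : ℕ} (M : CausalModel d) (f : Cov d → ℝ)
    (x : Cov d) : M.condMean (fun z => f z.2.1) x = f x := by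
  simp only [condMean, integral_const, probReal_univ, smul_eq_mul, one_mul]
  ring

theorem CausalModel.wNorm_comp_covariates {d n : ℕ} (M : CausalModel d) {w : Fin n → ℝ}
    (hw : ∀ j, 0 ≤ w j) (hw1 : ∑ j, w j = 1) (X : Fin n → Cov d) (f : Cov d → ℝ) :
    M.wNorm w 1 X (fun z => f z.2.1) = √(∑ j, w j * f (X j) ^ 2) := by
  have h := fun x' => M.condMean_comp_covariates (fun u => f u ^ 2) x'
  simp only [wNorm, pow_one, abs_of_nonneg (hw _), hw1, inv_one, one_mul, h]

end WeightedSums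

section Bracketing

variable {d n : ℕ}

/-- The ratio of the true to the estimated probability of treatment `a`. -/
noncomputable def CausalModel.armRatio (M : CausalModel d) (a : Bool) (p : Cov d → ℝ) (x : Cov d) :
    ℝ :=
  armProb a (M.propensity x) / armProb a (p x)

theorem CausalModel.armRatio_mem (M : CausalModel d) {a : Bool} {p : Cov d → ℝ} {x : Cov d} {ξ : ℝ}
    (hξ : 0 < ξ) (hp : p x ∈ Set.Icc ξ (1 - ξ)) : M.armRatio a p x ∈ Set.Icc 0 (1 / ξ) := by
  have h1 := armProb_mem (a := a) hp
  have h2 := armProb_mem (a := a) (p := M.propensity x) (ξ := 0)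
    ⟨(M.propensity_pos x).le, by linarith [M.propensity_lt_one x]⟩
  refine ⟨div_nonneg h2.1 (hξ.le.trans h1.1), ?_⟩
  unfold CausalModel.armRatio
  exact div_le_div₀ zero_le_one (by linarith [h2.2]) hξ h1.1

theorem CausalModel.abs_one_sub_armRatio_le (M : CausalModel d) {a : Bool} {p : Cov d → ℝ}
    {x : Cov d} {ξ : ℝ} (hξ : 0 < ξ) (hp : p x ∈ Set.Icc ξ (1 - ξ)) :
    |1 - M.armRatio a p x| ≤ 1 / ξ * |p x - M.propensity x| := by
  have h1 := (armProb_mem (a := a) hp).1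
  have h0 : 0 < armProb a (p x) := hξ.trans_le h1
  have : 1 - M.armRatio a p x =
      (armProb a (p x) - armProb a (M.propensity x)) / armProb a (p x) := by
    rw [sub_div, div_self h0.ne']
    rfl
  rw [this, abs_div, abs_of_pos h0, abs_armProb_sub, abs_sub_comm, div_eq_mul_one_div, mul_comm]
  exact mul_le_mul_of_nonneg_right (one_div_le_one_div_of_le hξ h1) (abs_nonneg _)

/-- The weighted indicators of `S` are close to their conditional means on average over the box. -/
def CausalModel.ThresholdClose (M : CausalModel d) (r : ℝ) (x : Cov d) (p : Cov d → ℝ)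
    (D : Fin n → Obs d) (a : Bool) (t : ℝ) (S : Set ℝ) : Prop :=
  |∑ j, boxKernel r x (D j).2.1 * (ipw a p (D j) * S.indicator (fun _ => 1) (D j).1 -
      M.armRatio a p (D j).2.1 * (M.outcome a (D j).2.1).real S)| <
    t * ∑ j, boxKernel r x (D j).2.1

/-- The weighted values of the regressor `u` are close to their conditional means on average over
the box. -/
def CausalModel.RegressorClose (M : CausalModel d) (r : ℝ) (x : Cov d) (p : Cov d → ℝ)
    (D : Fin n → Obs d) (a : Bool) (t : ℝ) (u : Cov d → ℝ) : Prop :=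
  |∑ j, boxKernel r x (D j).2.1 * ((1 - ipw a p (D j)) * u (D j).2.1 -
      (1 - M.armRatio a p (D j).2.1) * u (D j).2.1)| <
    t * ∑ j, boxKernel r x (D j).2.1

/-- The product of the nuisance errors is at most `b` on average over the box. -/
def CausalModel.NuisanceClose (M : CausalModel d) (r rF : ℝ) (x : Cov d) (p : Cov d → ℝ)
    (D₁ D₂ : Fin n → Obs d) (a : Bool) (b y : ℝ) : Prop :=
  ∑ j, nwWeight r x (fun i => (D₂ i).2.1) j * (|p (D₂ j).2.1 - M.propensity (D₂ j).2.1| *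
    |M.ccdf a y (D₂ j).2.1 - ccdfHat rF D₁ a y (D₂ j).2.1|) ≤ b

variable {M : CausalModel d} {𝒳 : Set (Cov d)} {𝒴 : Set ℝ} {x : Cov d} {Ω : Type*}
  [MeasurableSpace Ω] {P : Measure Ω} {Z : ℕ → Ω → Obs d}
  {piHat : (n : ℕ) → (Fin n → Obs d) → Cov d → ℝ} {α β γ ξ C Cα Cβ C₀ C₂ : ℝ}

/-- The error of the estimate of one conditional CDF, in terms of closeness at points that bracket
`y` up to probability `τ`. -/
theorem NWAssumptions.abs_armHat_sub_ccdf_le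
    (h : NWAssumptions M 𝒳 𝒴 x P Z piHat α β γ ξ C Cα Cβ C₀ C₂) (hC : 0 ≤ C)
    {D₁ D₂ : Fin n → Obs d} {p : Cov d → ℝ} (hp : ∀ x', p x' ∈ Set.Icc ξ (1 - ξ))
    (hX : ∀ j, (D₂ j).2.1 ∈ 𝒳) {r rF t τ b : ℝ} (hr : 0 ≤ r) (ht : 0 ≤ t) (hτ : 0 ≤ τ) (hb : 0 ≤ b)
    {a : Bool} {y : ℝ} (hy : y ∈ 𝒴)
    (hQ : (∀ x', ccdfHat rF D₁ a y x' = 0) ∨ M.RegressorClose r x p D₂ a t (ccdfHat rF D₁ a y))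
    (hup : (∃ c ∈ 𝒴, y ≤ c ∧ M.ccdf a c x ≤ M.ccdf a y x + τ ∧
        M.ThresholdClose r x p D₂ a t (Set.Iic c) ∧ M.NuisanceClose r rF x p D₁ D₂ a b c) ∨
      (1 ≤ M.ccdf a y x + τ ∧ M.ThresholdClose r x p D₂ a t Set.univ))
    (hlo : (∃ c ∈ 𝒴, c ≤ y ∧ M.ccdf a y x ≤ M.ccdf a c x + τ ∧
        M.ThresholdClose r x p D₂ a t (Set.Iic c) ∧ M.NuisanceClose r rF x p D₁ D₂ a b c) ∨
      M.ccdf a y x ≤ τ) :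
    |armHat r rF p D₁ D₂ a y x - M.ccdf a y x| ≤
      2 * t + 2 * (1 / ξ * (τ + 2 * (C * r ^ γ))) + 2 * (1 / ξ * b) + C * r ^ γ := by
  obtain ⟨hξ0, hξ2⟩ := h.overlap_const
  set κ := C * r ^ γ with hκ
  have hκ0 : 0 ≤ κ := mul_nonneg hC (Real.rpow_nonneg hr _)
  set w := nwWeight r x (fun i => (D₂ i).2.1) with hw
  have hw0 : ∀ j, 0 ≤ w j := fun j => nwWeight_nonneg _ _ _ _
  have hT : ∀ S, M.ThresholdClose r x p D₂ a t S → ∑ j, w j = 1 ∧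
      |∑ j, w j * (ipw a p (D₂ j) * S.indicator (fun _ => 1) (D₂ j).1 -
        M.armRatio a p (D₂ j).2.1 * (M.outcome a (D₂ j).2.1).real S)| ≤ t := fun S hS =>
    nwWeight_of_abs_box_sum_lt (X := fun i => (D₂ i).2.1) ht hS
  have hw1 : ∑ j, w j = 1 := by
    rcases hup with ⟨c, -, -, -, hc, -⟩ | ⟨-, hc⟩ <;> exact (hT _ hc).1
  have hnorm : ∀ j, 0 < w j → ‖x - (D₂ j).2.1‖ ≤ r := fun j hj =>
    norm_sub_le_of_nwWeight_pos (X := fun i => (D₂ i).2.1) (j := j) hj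
  have hbox : ∀ j, 0 < w j → ∀ c ∈ 𝒴, |M.ccdf a c x - M.ccdf a c (D₂ j).2.1| ≤ κ := fun j hj c hc =>
    (h.abs_ccdf_sub_le a hc h.mem_covariates (hX j)).trans (mul_le_mul_of_nonneg_left
      (Real.rpow_le_rpow (norm_nonneg _) (hnorm j hj) h.smoothness_γ.1.le) hC)
  have hrat := fun j => M.armRatio_mem (a := a) hξ0 (hp (D₂ j).2.1)
  have hrat1 := fun j => M.abs_one_sub_armRatio_le (a := a) hξ0 (hp (D₂ j).2.1)
  have hξ1 : 0 < 1 / ξ := by positivity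
  have hnuis : ∀ c, M.NuisanceClose r rF x p D₁ D₂ a b c →
      ∑ j, w j * (|1 - M.armRatio a p (D₂ j).2.1| *
        |M.ccdf a c (D₂ j).2.1 - ccdfHat rF D₁ a c (D₂ j).2.1|) ≤ 1 / ξ * b := fun c hc => by
    have hc' : ∑ j, w j * (|p (D₂ j).2.1 - M.propensity (D₂ j).2.1| *
      |M.ccdf a c (D₂ j).2.1 - ccdfHat rF D₁ a c (D₂ j).2.1|) ≤ b := hc
    have hc'' := mul_le_mul_of_nonneg_left hc' hξ1.le
    rw [Finset.mul_sum] at hc''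
    refine le_trans (Finset.sum_le_sum fun j _ => ?_) hc''
    have := mul_le_mul_of_nonneg_left (mul_le_mul_of_nonneg_right (hrat1 j)
      (abs_nonneg (M.ccdf a c (D₂ j).2.1 - ccdfHat rF D₁ a c (D₂ j).2.1))) (hw0 j)
    exact this.trans_eq (by ring)
  have hup' : ∃ Ip Gp ep : Fin n → ℝ, (∀ j, (if (D₂ j).1 ≤ y then (1 : ℝ) else 0) ≤ Ip j) ∧
      |∑ j, w j * (ipw a p (D₂ j) * Ip j - M.armRatio a p (D₂ j).2.1 * Gp j)| ≤ t ∧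
      (∀ j, 0 < w j → Gp j ≤ M.ccdf a y (D₂ j).2.1 + (τ + 2 * κ)) ∧
      (∀ j, 0 < w j → ccdfHat rF D₁ a y (D₂ j).2.1 ≤
        M.ccdf a y (D₂ j).2.1 + (τ + 2 * κ) + ep j) ∧
      (∀ j, 0 ≤ ep j) ∧
      ∑ j, w j * (|1 - M.armRatio a p (D₂ j).2.1| * ep j) ≤ 1 / ξ * b := by
    rcases hup with ⟨c, hc, hyc, hcF, hcT, hcN⟩ | ⟨hcF, hcT⟩
    · have hF : ∀ j, 0 < w j → M.ccdf a c (D₂ j).2.1 ≤ M.ccdf a y (D₂ j).2.1 + (τ + 2 * κ) :=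
        fun j hj => by linarith [abs_le.1 (hbox j hj c hc), abs_le.1 (hbox j hj y hy)]
      refine ⟨fun j => (Set.Iic c).indicator (fun _ => 1) (D₂ j).1,
        fun j => (M.outcome a (D₂ j).2.1).real (Set.Iic c),
        fun j => |M.ccdf a c (D₂ j).2.1 - ccdfHat rF D₁ a c (D₂ j).2.1|, fun j => ?_,
        (hT _ hcT).2, hF, fun j hj => ?_, fun j => abs_nonneg _, hnuis c hcN⟩
      · simp only [Set.indicator_apply, Set.mem_Iic]
        split_ifs with h1 h2 <;> first | exact absurd (h1.trans hyc) h2 | norm_num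
      · have h1 := ccdfHat_mono rF D₁ a (D₂ j).2.1 hyc
        have h2 := neg_abs_le (M.ccdf a c (D₂ j).2.1 - ccdfHat rF D₁ a c (D₂ j).2.1)
        simp only at h1
        linarith [hF j hj]
    · have hF : ∀ j, 0 < w j → 1 ≤ M.ccdf a y (D₂ j).2.1 + (τ + 2 * κ) :=
        fun j hj => by linarith [abs_le.1 (hbox j hj y hy)]
      refine ⟨fun j => Set.univ.indicator (fun _ => 1) (D₂ j).1,
        fun j => (M.outcome a (D₂ j).2.1).real Set.univ, fun _ => 0, fun j => ?_,
        (hT _ hcT).2, fun j hj => ?_, fun j hj => ?_,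
        fun j => le_rfl, by simpa using mul_nonneg (inv_nonneg.2 hξ0.le) hb⟩
      · simp only [Set.indicator_univ]
        split_ifs <;> norm_num
      · simpa using hF j hj
      · linarith [(ccdfHat_mem rF D₁ a y (D₂ j).2.1).2, hF j hj]
  have hlo' : ∃ Im Gm em : Fin n → ℝ, (∀ j, Im j ≤ (if (D₂ j).1 ≤ y then 1 else 0)) ∧
      |∑ j, w j * (ipw a p (D₂ j) * Im j - M.armRatio a p (D₂ j).2.1 * Gm j)| ≤ t ∧
      (∀ j, 0 < w j → M.ccdf a y (D₂ j).2.1 - (τ + 2 * κ) ≤ Gm j) ∧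
      (∀ j, 0 < w j → M.ccdf a y (D₂ j).2.1 - (τ + 2 * κ) - em j ≤
        ccdfHat rF D₁ a y (D₂ j).2.1) ∧
      (∀ j, 0 ≤ em j) ∧
      ∑ j, w j * (|1 - M.armRatio a p (D₂ j).2.1| * em j) ≤ 1 / ξ * b := by
    rcases hlo with ⟨c, hc, hyc, hcF, hcT, hcN⟩ | hcF
    · have hF : ∀ j, 0 < w j → M.ccdf a y (D₂ j).2.1 - (τ + 2 * κ) ≤ M.ccdf a c (D₂ j).2.1 :=
        fun j hj => by linarith [abs_le.1 (hbox j hj c hc), abs_le.1 (hbox j hj y hy)]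
      refine ⟨fun j => (Set.Iic c).indicator (fun _ => 1) (D₂ j).1,
        fun j => (M.outcome a (D₂ j).2.1).real (Set.Iic c),
        fun j => |M.ccdf a c (D₂ j).2.1 - ccdfHat rF D₁ a c (D₂ j).2.1|, fun j => ?_,
        (hT _ hcT).2, hF, fun j hj => ?_, fun j => abs_nonneg _, hnuis c hcN⟩
      · simp only [Set.indicator_apply, Set.mem_Iic]
        split_ifs with h1 h2 <;> first | exact absurd (h1.trans hyc) h2 | norm_num
      · have h1 := ccdfHat_mono rF D₁ a (D₂ j).2.1 hyc
        have h2 := le_abs_self (M.ccdf a c (D₂ j).2.1 - ccdfHat rF D₁ a c (D₂ j).2.1)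
        simp only at h1
        linarith [hF j hj]
    · have hF : ∀ j, 0 < w j → M.ccdf a y (D₂ j).2.1 - (τ + 2 * κ) ≤ 0 :=
        fun j hj => by linarith [abs_le.1 (hbox j hj y hy)]
      refine ⟨fun _ => 0, fun _ => 0, fun _ => 0, fun j => ?_, by simpa using ht, hF,
        fun j hj => ?_, fun j => le_rfl, by simpa using mul_nonneg (inv_nonneg.2 hξ0.le) hb⟩
      · split_ifs <;> norm_num
      · linarith [(ccdfHat_mem rF D₁ a y (D₂ j).2.1).1, hF j hj]
  have hQ' : |∑ j, w j * ((1 - ipw a p (D₂ j)) * ccdfHat rF D₁ a y (D₂ j).2.1 -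
      (1 - M.armRatio a p (D₂ j).2.1) * ccdfHat rF D₁ a y (D₂ j).2.1)| ≤ t := by
    rcases hQ with h0 | hQ
    · simpa [h0] using ht
    · exact (nwWeight_of_abs_box_sum_lt (X := fun i => (D₂ i).2.1) ht hQ).2
  obtain ⟨Ip, Gp, ep, u1, u2, u3, u4, u5, u6⟩ := hup'
  obtain ⟨Im, Gm, em, l1, l2, l3, l4, l5, l6⟩ := hlo'
  have main := abs_sum_doublyRobust_sub_le hw0 hw1 (Δ := τ + 2 * κ) (by positivity)
    (fun j => (ipw_mem (a := a) hξ0 (hp (D₂ j).2.1)).1) (fun j _ => hrat j)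
    (fun j _ => ?_) hQ' u1 u2 u3 u4 l1 l2 l3 l4 u5 l5 u6 l6
  · have hF : |∑ j, w j * M.ccdf a y (D₂ j).2.1 - M.ccdf a y x| ≤ κ := by
      have hc : ∀ c : ℝ, ∑ j, w j * c = c := fun c => by rw [← Finset.sum_mul, hw1, one_mul]
      have e1 : ∑ j, w j * M.ccdf a y (D₂ j).2.1 ≤ ∑ j, w j * (M.ccdf a y x + κ) :=
        sum_mul_le_sum_mul_of_pos hw0 fun j hj => by linarith [abs_le.1 (hbox j hj y hy)]
      have e2 : ∑ j, w j * (M.ccdf a y x - κ) ≤ ∑ j, w j * M.ccdf a y (D₂ j).2.1 :=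
        sum_mul_le_sum_mul_of_pos hw0 fun j hj => by linarith [abs_le.1 (hbox j hj y hy)]
      rw [hc] at e1 e2
      exact abs_le.2 ⟨by linarith, by linarith⟩
    exact (abs_sub_le _ _ _).trans (add_le_add main hF)
  · have h1 := hrat j
    have h2 : 1 ≤ 1 / ξ := by
      rw [le_div_iff₀ hξ0]
      linarith
    exact abs_le.2 ⟨by linarith [h1.2], by linarith [h1.1]⟩

end Bracketing

/-- Truncation of a propensity score to `[ξ, 1 - ξ]`. -/
noncomputable def clampPropensity {d : ℕ} (ξ : ℝ) (p : Cov d → ℝ) (x : Cov d) : ℝ :=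
  max ξ (min (p x) (1 - ξ))

theorem clampPropensity_mem {d : ℕ} {ξ : ℝ} (hξ : ξ ≤ 1 / 2) (p : Cov d → ℝ) (x : Cov d) :
    clampPropensity ξ p x ∈ Set.Icc ξ (1 - ξ) :=
  ⟨le_max_left _ _, max_le (by linarith) (min_le_right _ _)⟩

theorem clampPropensity_eq {d : ℕ} {ξ : ℝ} {p : Cov d → ℝ} {x : Cov d}
    (h : p x ∈ Set.Icc ξ (1 - ξ)) : clampPropensity ξ p x = p x := by
  rw [clampPropensity, min_eq_left h.2, max_eq_right h.1]

namespace CausalModel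

variable {d : ℕ} (M : CausalModel d)

theorem condMean_ipw_mul_indicator (a : Bool) (p : Cov d → ℝ) {S : Set ℝ} (hS : MeasurableSet S)
    (x : Cov d) : M.condMean (fun z => ipw a p z * S.indicator (fun _ => 1) z.1) x =
      M.armRatio a p x * (M.outcome a x).real S := by
  have h : ∀ c : ℝ, ∫ y, c * S.indicator (fun _ => (1 : ℝ)) y ∂(M.outcome a x) =
      c * (M.outcome a x).real S := fun c => by
    rw [integral_const_mul, integral_indicator_const _ hS, smul_eq_mul, mul_one]
  cases a <;> simp only [condMean, ipw, armRatio, Bool.false_eq_true, Bool.true_eq_false, if_true,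
    if_false, h, zero_div, zero_mul, integral_zero, armProb] <;> ring

theorem condMean_one_sub_ipw_mul (a : Bool) (p u : Cov d → ℝ) (x : Cov d) :
    M.condMean (fun z => (1 - ipw a p z) * u z.2.1) x = (1 - M.armRatio a p x) * u x := by
  cases a <;> simp only [condMean, ipw, armRatio, Bool.false_eq_true, Bool.true_eq_false, if_true,
    if_false, integral_const, probReal_univ, smul_eq_mul, armProb] <;> ring

end CausalModel

theorem two_mul_ofReal_exp_le {m Λ L δ : ℝ} (hΛ : 0 < Λ) (hm : Λ ≤ m) (hL : 0 ≤ L)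
    (h8 : 8 * L ≤ Λ) (hδ : 0 < δ) (hlog : Real.log (2 / δ) ≤ 4 * L) :
    2 * ENNReal.ofReal (Real.exp (-(m * (1 - Real.exp (-(8 * L / Λ)))))) ≤ ENNReal.ofReal δ := by
  set u := 8 * L / Λ with hu
  have hu0 : 0 ≤ u := by positivity
  have hu1 : u ≤ 1 := (div_le_one hΛ).2 h8
  have h1 : Real.exp (-u) ≤ 1 - u / 2 := by
    rw [Real.exp_neg, inv_le_iff_one_le_mul₀ (Real.exp_pos _)]
    have := Real.add_one_le_exp u
    nlinarith
  have h2 : 4 * L ≤ m * (1 - Real.exp (-u)) := by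
    have h3 : 4 * L = Λ * (u / 2) := by
      rw [hu]
      field_simp
      ring
    rw [h3]
    exact mul_le_mul hm (by linarith) (by positivity) (hΛ.le.trans hm)
  rw [show (2 : ENNReal) = ENNReal.ofReal 2 by simp, ← ENNReal.ofReal_mul zero_le_two]
  apply ENNReal.ofReal_le_ofReal
  have h4 : Real.exp (-(m * (1 - Real.exp (-u)))) ≤ Real.exp (-Real.log (2 / δ)) :=
    Real.exp_le_exp.2 (by linarith)
  rw [Real.exp_neg (Real.log _), Real.exp_log (by positivity), inv_div] at h4
  linarith

section Radius

variable {d n : ℕ} {γ : ℝ}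

theorem optRadius_rpow (hγ : 0 < γ) :
    optRadius d γ n ^ γ = ((n : ℝ) ^ (1 / (2 + d / γ)))⁻¹ := by
  rw [optRadius, ← Real.rpow_mul n.cast_nonneg, ← Real.rpow_neg n.cast_nonneg]
  congr 1
  field_simp

theorem mul_optRadius_pow (hγ : 0 < γ) (hn : 1 ≤ n) :
    n * optRadius d γ n ^ d = ((n : ℝ) ^ (1 / (2 + d / γ))) ^ 2 := by
  have hn' : (0 : ℝ) < n := by exact_mod_cast hn
  rw [optRadius, ← Real.rpow_natCast, ← Real.rpow_mul hn'.le, ← Real.rpow_natCast _ 2,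
    ← Real.rpow_mul hn'.le]
  nth_rewrite 1 [← Real.rpow_one (n : ℝ)]
  rw [← Real.rpow_add hn']
  congr 1
  push_cast
  field_simp
  ring

theorem tendsto_optRadius (hγ : 0 < γ) : Tendsto (optRadius d γ) atTop (𝓝 0) :=
  (tendsto_rpow_neg_atTop (by positivity : 0 < 1 / (2 * γ + d))).comp tendsto_natCast_atTop_atTop

end Radius

namespace NWAssumptions

variable {d : ℕ} {M : CausalModel d} {𝒳 : Set (Cov d)} {𝒴 : Set ℝ} {x : Cov d} {Ω : Type*}
  [MeasurableSpace Ω] {P : Measure Ω} {Z : ℕ → Ω → Obs d}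
  {piHat : (n : ℕ) → (Fin n → Obs d) → Cov d → ℝ} {α β γ ξ C Cα Cβ C₀ C₂ : ℝ} {n : ℕ}

theorem measurable_ipw_clamp (h : NWAssumptions M 𝒳 𝒴 x P Z piHat α β γ ξ C Cα Cβ C₀ C₂) (n : ℕ)
    (a : Bool) : Measurable fun q : (Fin n → Obs d) × Obs d =>
      ipw a (clampPropensity ξ (piHat n q.1)) q.2 := by
  have h1 : Measurable fun q : (Fin n → Obs d) × Obs d => piHat n q.1 q.2.2.1 :=
    (h.measurable_piHat n).comp (measurable_fst.prodMk measurable_snd.snd.fst)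
  have h2 : Measurable fun q : (Fin n → Obs d) × Obs d =>
      clampPropensity ξ (piHat n q.1) q.2.2.1 :=
    measurable_const.max (h1.min measurable_const)
  unfold ipw
  exact (Measurable.ite (measurable_snd.snd.snd (measurableSet_singleton a)) measurable_const
    measurable_const).div (measurable_armProb a h2)

theorem sq_deviation_div (hξ : 0 < ξ) (hC₀ : 0 < C₀) {L V : ℝ} (hL : 0 ≤ L) (hV : 0 < V) :
    (4 / ξ * √(L / C₀) / V) ^ 2 / (2 * (1 / ξ) ^ 2) = 8 * L / (C₀ * V ^ 2) := by
  rw [div_pow, mul_pow, Real.sq_sqrt (by positivity)]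
  field_simp
  ring

theorem measure_not_thresholdClose_le [IsProbabilityMeasure P]
    (h : NWAssumptions M 𝒳 𝒴 x P Z piHat α β γ ξ C Cα Cβ C₀ C₂) (hC₀ : 0 < C₀) {V r : ℝ}
    (hV : 0 < V) (hball : C₀ * V ^ 2 ≤ n * M.covLaw.real (Metric.closedBall x r)) {L δ : ℝ}
    (hL : 0 ≤ L) (h8 : 8 * L ≤ C₀ * V ^ 2) (hδ : 0 < δ) (hlog : Real.log (2 / δ) ≤ 4 * L)
    (a : Bool) {S : Set ℝ} (hS : MeasurableSet S) :
    P {ω | ¬ M.ThresholdClose r x (clampPropensity ξ (piHat n (firstSplit Z n ω)))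
      (secondSplit Z n ω) a (4 / ξ * √(L / C₀) / V) S} ≤ ENNReal.ofReal δ := by
  obtain ⟨hξ0, hξ2⟩ := h.overlap_const
  have hi := h.measurable_ipw_clamp n a
  have hind : Measurable fun q : (Fin n → Obs d) × Obs d => S.indicator (fun _ => (1 : ℝ)) q.2.1 :=
    (measurable_const.indicator hS).comp measurable_snd.fst
  have hbd : ∀ q : (Fin n → Obs d) × Obs d, |ipw a (clampPropensity ξ (piHat n q.1)) q.2 *
      S.indicator (fun _ => (1 : ℝ)) q.2.1| ≤ 1 / ξ := fun q => by
    have h1 := ipw_mem (a := a) hξ0 (clampPropensity_mem hξ2 (piHat n q.1) q.2.2.1)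
    rw [abs_mul, abs_of_nonneg h1.1]
    refine (mul_le_of_le_one_right h1.1 ?_).trans h1.2
    by_cases hq : q.2.1 ∈ S <;> simp [hq]
  have key := measure_splits_le (P := P) (M := M) h.measurable_data h.indep_data h.law_data
    (hi.mul hind) (B := 1 / ξ) (t := 4 / ξ * √(L / C₀) / V) (by positivity) (by positivity) hbd x r
  rw [sq_deviation_div hξ0 hC₀ hL hV] at key
  refine le_trans (le_of_eq ?_)
    (key.trans (two_mul_ofReal_exp_le (by positivity) hball hL h8 hδ hlog))
  congr 1
  ext ω
  simp only [CausalModel.ThresholdClose, Set.mem_ofPred_eq, not_lt, Pi.mul_apply,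
    M.condMean_ipw_mul_indicator a _ hS]

theorem measure_not_regressorClose_le [IsProbabilityMeasure P]
    (h : NWAssumptions M 𝒳 𝒴 x P Z piHat α β γ ξ C Cα Cβ C₀ C₂) (hC₀ : 0 < C₀) {V r : ℝ}
    (hV : 0 < V) (hball : C₀ * V ^ 2 ≤ n * M.covLaw.real (Metric.closedBall x r)) {L δ : ℝ}
    (hL : 0 ≤ L) (h8 : 8 * L ≤ C₀ * V ^ 2) (hδ : 0 < δ) (hlog : Real.log (2 / δ) ≤ 4 * L)
    (a : Bool) (rF : ℝ) {y : (Fin n → Obs d) → ℝ} (hy : Measurable y) :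
    P {ω | ¬ M.RegressorClose r x (clampPropensity ξ (piHat n (firstSplit Z n ω)))
      (secondSplit Z n ω) a (4 / ξ * √(L / C₀) / V)
      (ccdfHat rF (firstSplit Z n ω) a (y (firstSplit Z n ω)))} ≤ ENNReal.ofReal δ := by
  obtain ⟨hξ0, hξ2⟩ := h.overlap_const
  have hi := h.measurable_ipw_clamp n a
  have hu : Measurable fun q : (Fin n → Obs d) × Obs d => ccdfHat rF q.1 a (y q.1) q.2.2.1 :=
    measurable_ccdfHat rF a measurable_fst (hy.comp measurable_fst) measurable_snd.snd.fst
  have hbd : ∀ q : (Fin n → Obs d) × Obs d,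
      |(1 - ipw a (clampPropensity ξ (piHat n q.1)) q.2) * ccdfHat rF q.1 a (y q.1) q.2.2.1| ≤
        1 / ξ := fun q => by
    have h1 := ipw_mem (a := a) hξ0 (clampPropensity_mem hξ2 (piHat n q.1) q.2.2.1)
    have h2 := ccdfHat_mem rF q.1 a (y q.1) q.2.2.1
    have h3 : 1 ≤ 1 / ξ := by
      rw [le_div_iff₀ hξ0]
      linarith
    rw [abs_mul, abs_of_nonneg h2.1]
    refine (mul_le_of_le_one_right (abs_nonneg _) h2.2).trans ?_
    exact abs_le.2 ⟨by linarith [h1.2], by linarith [h1.1]⟩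
  have key := measure_splits_le (P := P) (M := M) h.measurable_data h.indep_data h.law_data
    ((hi.const_sub 1).mul hu) (B := 1 / ξ) (t := 4 / ξ * √(L / C₀) / V) (by positivity)
    (by positivity) hbd x r
  rw [sq_deviation_div hξ0 hC₀ hL hV] at key
  refine le_trans (le_of_eq ?_)
    (key.trans (two_mul_ofReal_exp_le (by positivity) hball hL h8 hδ hlog))
  congr 1
  ext ω
  simp only [CausalModel.RegressorClose, Set.mem_ofPred_eq, not_lt, Pi.mul_apply,
    M.condMean_one_sub_ipw_mul a]

theorem ae_mem_covariates (h : NWAssumptions M 𝒳 𝒴 x P Z piHat α β γ ξ C Cα Cβ C₀ C₂) :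
    ∀ᵐ z ∂M.law, z.2.1 ∈ 𝒳 ∧ z.1 ∈ 𝒴 := by
  have hs : MeasurableSet {z : Obs d | ¬ (z.2.1 ∈ 𝒳 ∧ z.1 ∈ 𝒴)} :=
    ((h.measurableSet_covariates.preimage measurable_snd.fst).inter
      (h.measurableSet_responses.preimage measurable_fst)).compl
  rw [ae_iff, ← lintegral_indicator_one hs, M.lintegral_law (measurable_one.indicator hs)]
  have hx : ∀ᵐ x' ∂M.covLaw, x' ∈ 𝒳 := h.covLaw_compl
  refine (lintegral_congr_ae (g := fun _ => 0) ?_).trans lintegral_zero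
  · filter_upwards [hx] with x' hx'
    rw [lintegral_indicator_one hs, CausalModel.condLaw]
    simp only [Measure.add_apply, Measure.smul_apply, smul_eq_mul]
    rw [Measure.map_apply (by fun_prop) hs, Measure.map_apply (by fun_prop) hs]
    have h0 : ∀ a : Bool, M.outcome a x'
        ((fun y => (y, x', a)) ⁻¹' {z : Obs d | ¬ (z.2.1 ∈ 𝒳 ∧ z.1 ∈ 𝒴)}) = 0 := fun a =>
      measure_mono_null (fun y hy => by
        intro hy'
        exact hy ⟨hx', hy'⟩) (h.outcome_compl a x' hx')
    rw [h0, h0]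
    simp

/-- Almost surely all data lie in the covariate and response spaces. -/
theorem ae_data_mem (h : NWAssumptions M 𝒳 𝒴 x P Z piHat α β γ ξ C Cα Cβ C₀ C₂) :
    ∀ᵐ ω ∂P, ∀ i, (Z i ω).2.1 ∈ 𝒳 ∧ (Z i ω).1 ∈ 𝒴 := by
  rw [ae_all_iff]
  intro i
  have := h.ae_mem_covariates
  rw [← h.law_data i] at this
  exact ae_of_ae_map (h.measurable_data i).aemeasurable this

theorem measure_not_nuisanceClose_le
    (h : NWAssumptions M 𝒳 𝒴 x P Z piHat α β γ ξ C Cα Cβ C₀ C₂) (hCα : 0 < Cα) (hCβ : 0 < Cβ)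
    (hn : 1 ≤ n) {L δ : ℝ} (hδ : δ ∈ Set.Ioo 0 (Real.exp (-1)))
    (hlog : Real.log (2 / δ) ≤ 4 * L) (a : Bool) {y : ℝ} (hy : y ∈ 𝒴) :
    P {ω | ¬ M.NuisanceClose (optRadius d γ n) (optRadius d β n) x
      (clampPropensity ξ (piHat n (firstSplit Z n ω))) (firstSplit Z n ω) (secondSplit Z n ω) a
      (Cα * Cβ * (4 * L) / (n : ℝ) ^ (1 / (2 + d / α) + 1 / (2 + d / β))) y} ≤
        ENNReal.ofReal δ := by
  have hn' : (0 : ℝ) < n := by exact_mod_cast hn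
  have hlog1 : 0 ≤ Real.log (1 / δ) := Real.log_nonneg (by
    rw [le_div_iff₀ hδ.1, one_mul]
    exact hδ.2.le.trans (Real.exp_le_one_iff.2 (by norm_num)))
  have hlog2 : Real.log (1 / δ) ≤ 4 * L := le_trans (Real.log_le_log (by have := hδ.1; positivity)
    (by have := hδ.1; gcongr; norm_num)) hlog
  refine (measure_mono_ae ?_).trans (h.nuisance_rate a y hy n hn δ hδ)
  filter_upwards [h.ae_data_mem, h.overlap_hat n] with ω hω hov hbad hgood
  refine hbad ?_
  obtain ⟨g1, g2⟩ := hgood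
  have hX : ∀ j, (secondSplit Z n ω j).2.1 ∈ 𝒳 := fun j => (hω (n + j)).1
  unfold CausalModel.NuisanceClose
  set w := nwWeight (optRadius d γ n) x fun i => (secondSplit Z n ω i).2.1 with hw
  have hw0 : ∀ j, 0 ≤ w j := fun j => nwWeight_nonneg _ _ _ _
  have hb : 0 ≤ Cα * Cβ * (4 * L) / (n : ℝ) ^ (1 / (2 + d / α) + 1 / (2 + d / β)) :=
    div_nonneg (mul_nonneg (by positivity) (hlog1.trans hlog2)) (Real.rpow_nonneg hn'.le _)
  by_cases hK : ∑ i, boxKernel (optRadius d γ n) x (secondSplit Z n ω i).2.1 = 0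
  · refine le_trans (le_of_eq (Finset.sum_eq_zero fun j _ => ?_)) hb
    rw [hw, nwWeight, hK, div_zero, zero_mul]
  have hw1 : ∑ j, w j = 1 := by
    simp only [hw, nwWeight]
    rw [← Finset.sum_div, div_self hK]
  rw [M.wNorm_comp_covariates hw0 hw1 (fun i => (secondSplit Z n ω i).2.1)
    (fun u => piHat n (firstSplit Z n ω) u - M.propensity u)] at g1
  rw [M.wNorm_comp_covariates hw0 hw1 (fun i => (secondSplit Z n ω i).2.1)
    (fun u => M.ccdf a y u - ccdfHat (optRadius d β n) (firstSplit Z n ω) a y u)] at g2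
  have hcl : ∀ j, clampPropensity ξ (piHat n (firstSplit Z n ω)) (secondSplit Z n ω j).2.1 =
      piHat n (firstSplit Z n ω) (secondSplit Z n ω j).2.1 := fun j =>
    clampPropensity_eq (hov _ (hX j))
  simp only [hcl]
  refine (sum_mul_abs_mul_abs_le hw0 _ _).trans ((mul_le_mul g1 g2 (Real.sqrt_nonneg _)
    ((Real.sqrt_nonneg _).trans g1)).trans ?_)
  have e : Cα * √(Real.log (1 / δ)) * (n : ℝ) ^ (-(1 / (2 + d / α))) *
      (Cβ * √(Real.log (1 / δ)) * (n : ℝ) ^ (-(1 / (2 + d / β)))) =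
      Cα * Cβ * Real.log (1 / δ) / (n : ℝ) ^ (1 / (2 + d / α) + 1 / (2 + d / β)) := by
    rw [div_eq_mul_inv (Cα * Cβ * _), ← Real.rpow_neg hn'.le, neg_add, Real.rpow_add hn']
    linear_combination Cα * Cβ * (n : ℝ) ^ (-(1 / (2 + d / α))) * (n : ℝ) ^ (-(1 / (2 + d / β))) *
      Real.mul_self_sqrt hlog1
  rw [e]
  gcongr

end NWAssumptions

/-- The constant in the error bound for one arm. -/
noncomputable def armConst (C Cα Cβ C₀ : ℝ) : ℝ := 8 / √C₀ + 5 * C + 4 + 8 * (Cα * Cβ)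

theorem arm_error_le {C Cα Cβ C₀ ξ L V W τ : ℝ} (hC : 0 ≤ C) (hCα : 0 ≤ Cα) (hCβ : 0 ≤ Cβ)
    (hC₀ : 0 < C₀) (hξ : ξ ∈ Set.Ioc (0 : ℝ) (1 / 2)) (hL : 1 ≤ L) (hV : 0 < V) (hW : 0 < W)
    (hτ : τ ≤ 2 / V) :
    2 * (4 / ξ * √(L / C₀) / V) + 2 * (1 / ξ * (τ + 2 * (C * V⁻¹))) +
      2 * (1 / ξ * (Cα * Cβ * (4 * L) / W)) + C * V⁻¹ ≤
      armConst C Cα Cβ C₀ / ξ * (L / min V W) := by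
  obtain ⟨hξ0, hξ2⟩ := hξ
  set E := min V W with hE
  have hE0 : 0 < E := lt_min hV hW
  have hL0 : 0 < L := by linarith
  have hVE : V⁻¹ ≤ L / E := by
    rw [← one_div]
    exact div_le_div₀ hL0.le hL hE0 (min_le_left _ _)
  have hWE : L / W ≤ L / E := div_le_div_of_nonneg_left hL0.le hE0 (min_le_right _ _)
  have hsq : √(L / C₀) ≤ L / √C₀ := by
    rw [Real.sqrt_div' _ hC₀.le]
    gcongr
    exact Real.sqrt_le_iff.2 ⟨hL0.le, by nlinarith⟩
  have hξ1 : 1 ≤ 1 / ξ := by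
    rw [le_div_iff₀ hξ0]
    linarith
  have h1 : 2 * (4 / ξ * √(L / C₀) / V) ≤ 8 / √C₀ / ξ * (L / E) := by
    calc 2 * (4 / ξ * √(L / C₀) / V) ≤ 2 * (4 / ξ * (L / √C₀) / E) := by
          gcongr
          exact min_le_left _ _
      _ = _ := by ring
  have h2 : 2 * (1 / ξ * (τ + 2 * (C * V⁻¹))) ≤ (4 + 4 * C) / ξ * (L / E) := by
    have : τ + 2 * (C * V⁻¹) ≤ (2 + 2 * C) * (L / E) := by
      rw [div_eq_mul_inv] at hτ
      nlinarith
    calc 2 * (1 / ξ * (τ + 2 * (C * V⁻¹))) ≤ 2 * (1 / ξ * ((2 + 2 * C) * (L / E))) := by gcongr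
      _ = _ := by ring
  have h3 : 2 * (1 / ξ * (Cα * Cβ * (4 * L) / W)) ≤ 8 * (Cα * Cβ) / ξ * (L / E) := by
    have : Cα * Cβ * (L / W) ≤ Cα * Cβ * (L / E) := by gcongr
    calc 2 * (1 / ξ * (Cα * Cβ * (4 * L) / W)) = 8 / ξ * (Cα * Cβ * (L / W)) := by ring
      _ ≤ 8 / ξ * (Cα * Cβ * (L / E)) := by gcongr
      _ = _ := by ring
  have h4 : C * V⁻¹ ≤ C / ξ * (L / E) := by
    calc C * V⁻¹ ≤ C * (L / E) := by gcongr
      _ ≤ C * (L / E) * (1 / ξ) := le_mul_of_one_le_right (by positivity) hξ1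
      _ = _ := by ring
  have : armConst C Cα Cβ C₀ / ξ * (L / E) = 8 / √C₀ / ξ * (L / E) + (4 + 4 * C) / ξ * (L / E) +
      8 * (Cα * Cβ) / ξ * (L / E) + C / ξ * (L / E) := by
    unfold armConst
    ring
  linarith

namespace NWAssumptions

variable {d : ℕ} {M : CausalModel d} {𝒳 : Set (Cov d)} {𝒴 : Set ℝ} {x : Cov d} {Ω : Type*}
  [MeasurableSpace Ω] {P : Measure Ω} {Z : ℕ → Ω → Obs d}
  {piHat : (n : ℕ) → (Fin n → Obs d) → Cov d → ℝ} {α β γ ξ C Cα Cβ C₀ C₂ : ℝ} {n : ℕ}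

/-- The estimate of the conditional CDF of arm `a`, from the truncated propensity estimate. -/
noncomputable def sampleArmHat (Z : ℕ → Ω → Obs d)
    (piHat : (n : ℕ) → (Fin n → Obs d) → Cov d → ℝ) (β γ ξ : ℝ) (n : ℕ) (x : Cov d) (a : Bool)
    (y : ℝ) (ω : Ω) : ℝ :=
  armHat (optRadius d γ n) (optRadius d β n) (clampPropensity ξ (piHat n (firstSplit Z n ω)))
    (firstSplit Z n ω) (secondSplit Z n ω) a y x

section Arm

variable [IsProbabilityMeasure P] (h : NWAssumptions M 𝒳 𝒴 x P Z piHat α β γ ξ C Cα Cβ C₀ C₂)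
  (hC : 1 ≤ C) (hCα : 0 < Cα) (hCβ : 0 < Cβ) (hC₀ : 0 < C₀) (hn : 1 ≤ n)
  (hball : C₀ * ((n : ℝ) ^ (1 / (2 + d / γ))) ^ 2 ≤
    n * M.covLaw.real (Metric.closedBall x (optRadius d γ n)))
  {L δ : ℝ} (hL : 1 ≤ L) (h8 : 8 * L ≤ C₀ * ((n : ℝ) ^ (1 / (2 + d / γ))) ^ 2)
  (hδ : δ ∈ Set.Ioo 0 (Real.exp (-1))) (hlog : Real.log (2 / δ) ≤ 4 * L) (a : Bool)

include h hC hCα hCβ hC₀ hn hball hL h8 hδ hlog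

theorem measure_not_abs_sampleArmHat_le {y : ℝ} (hy : y ∈ 𝒴) :
    P {ω | ¬ |sampleArmHat Z piHat β γ ξ n x a y ω - M.ccdf a y x| ≤
      armConst C Cα Cβ C₀ / ξ * (L / contrastRate d α β γ n)} ≤ 3 * ENNReal.ofReal δ := by
  have hn' : (0 : ℝ) < n := by exact_mod_cast hn
  have hV : 0 < (n : ℝ) ^ (1 / (2 + d / γ)) := Real.rpow_pos_of_pos hn' _
  have hW : 0 < (n : ℝ) ^ (1 / (2 + d / α) + 1 / (2 + d / β)) := Real.rpow_pos_of_pos hn' _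
  have e1 := h.measure_not_thresholdClose_le hC₀ hV hball (by linarith) h8 hδ.1 hlog a
    (measurableSet_Iic (a := y))
  have e2 := h.measure_not_regressorClose_le hC₀ hV hball (by linarith) h8 hδ.1 hlog a
    (optRadius d β n) (measurable_const (a := y))
  have e3 := h.measure_not_nuisanceClose_le hCα hCβ hn hδ hlog a hy
  rw [show (3 : ENNReal) * ENNReal.ofReal δ =
    ENNReal.ofReal δ + ENNReal.ofReal δ + ENNReal.ofReal δ by ring]
  refine le_trans (measure_mono_ae ?_) ((measure_union_le _ _).trans
    (add_le_add ((measure_union_le _ _).trans (add_le_add e1 e2)) e3))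
  filter_upwards [h.ae_data_mem] with ω hω hbad
  by_contra hgood
  refine hbad ?_
  have g1 : M.ThresholdClose (optRadius d γ n) x _ _ a _ (Set.Iic y) :=
    not_not.1 fun hh => hgood (Or.inl (Or.inl hh))
  have g2 : M.RegressorClose (optRadius d γ n) x _ _ a _ (ccdfHat _ _ a y) :=
    not_not.1 fun hh => hgood (Or.inl (Or.inr hh))
  have g3 : M.NuisanceClose (optRadius d γ n) (optRadius d β n) x _ _ _ a _ y :=
    not_not.1 fun hh => hgood (Or.inr hh)
  have key := h.abs_armHat_sub_ccdf_le (r := optRadius d γ n) (D₁ := firstSplit Z n ω)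
    (D₂ := secondSplit Z n ω) (p := clampPropensity ξ (piHat n (firstSplit Z n ω)))
    (zero_le_one.trans hC)
    (fun x' => clampPropensity_mem h.overlap_const.2 _ x')
    (fun j => (hω (n + j)).1) (Real.rpow_nonneg hn'.le _)
    (by have := h.overlap_const.1; positivity) le_rfl
    (div_nonneg (by positivity) hW.le) hy (Or.inr g2)
    (Or.inl ⟨y, hy, le_rfl, by simp, g1, g3⟩) (Or.inl ⟨y, hy, le_rfl, by simp, g1, g3⟩)
  rw [optRadius_rpow h.smoothness_γ.1] at key
  exact key.trans (arm_error_le (zero_le_one.trans hC) hCα.le hCβ.le hC₀ h.overlap_const hL hV hW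
    (by positivity))

theorem measure_not_forall_abs_sampleArmHat_le :
    P {ω | ¬ ∀ y ∈ 𝒴, |sampleArmHat Z piHat β γ ξ n x a y ω - M.ccdf a y x| ≤
      armConst C Cα Cβ C₀ / ξ * (L / contrastRate d α β γ n)} ≤
        (4 * n : ℕ) * ENNReal.ofReal δ := by
  have hn' : (0 : ℝ) < n := by exact_mod_cast hn
  have hV : 0 < (n : ℝ) ^ (1 / (2 + d / γ)) := Real.rpow_pos_of_pos hn' _
  have hW : 0 < (n : ℝ) ^ (1 / (2 + d / α) + 1 / (2 + d / β)) := Real.rpow_pos_of_pos hn' _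
  have hγ := h.smoothness_γ.1
  have := h.noAtoms a h.mem_covariates
  obtain ⟨c, hc, hbr⟩ := exists_bracketing (h.outcome_compl a x h.mem_covariates) hn
  have e0 := h.measure_not_thresholdClose_le hC₀ hV hball (by linarith) h8 hδ.1 hlog a
    MeasurableSet.univ
  have e1 := fun k => h.measure_not_thresholdClose_le hC₀ hV hball (by linarith) h8 hδ.1 hlog a
    (measurableSet_Iic (a := c k))
  have e2 := fun i : Fin n => h.measure_not_regressorClose_le hC₀ hV hball (by linarith) h8 hδ.1
    hlog a (optRadius d β n) (y := fun D => (D i).1) (measurable_pi_apply i).fst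
  have e3 := fun k => h.measure_not_nuisanceClose_le hCα hCβ hn hδ hlog a (hc k)
  have hsum : ∀ {E : Fin n → Set Ω}, (∀ k, P (E k) ≤ ENNReal.ofReal δ) →
      P (⋃ k, E k) ≤ n * ENNReal.ofReal δ := fun {E} hE =>
    (measure_iUnion_fintype_le P E).trans ((Finset.sum_le_sum fun k _ => hE k).trans_eq (by simp))
  refine le_trans (measure_mono_ae ?_) (le_trans ((measure_union_le _ _).trans
    (add_le_add ((measure_union_le _ _).trans (add_le_add ((measure_union_le _ _).trans
      (add_le_add e0 (hsum e1))) (hsum e2))) (hsum e3))) ?_)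
  · filter_upwards [h.ae_data_mem] with ω hω hbad
    by_contra hgood
    refine hbad fun y hy => ?_
    have g0 : M.ThresholdClose (optRadius d γ n) x _ _ a _ Set.univ :=
      not_not.1 fun hh => hgood (Or.inl (Or.inl (Or.inl hh)))
    have g1 : ∀ k, M.ThresholdClose (optRadius d γ n) x _ _ a _ (Set.Iic (c k)) := fun k =>
      not_not.1 fun hh => hgood (Or.inl (Or.inl (Or.inr (Set.mem_iUnion.2 ⟨k, hh⟩))))
    have g2 : ∀ i : Fin n, M.RegressorClose (optRadius d γ n) x _ _ a _
        (ccdfHat _ _ a (firstSplit Z n ω i).1) := fun i =>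
      not_not.1 fun hh => hgood (Or.inl (Or.inr (Set.mem_iUnion.2 ⟨i, hh⟩)))
    have g3 : ∀ k, M.NuisanceClose (optRadius d γ n) (optRadius d β n) x _ _ _ a _ (c k) :=
      fun k => not_not.1 fun hh => hgood (Or.inr (Set.mem_iUnion.2 ⟨k, hh⟩))
    have key := h.abs_armHat_sub_ccdf_le (r := optRadius d γ n) (D₁ := firstSplit Z n ω)
      (D₂ := secondSplit Z n ω) (p := clampPropensity ξ (piHat n (firstSplit Z n ω)))
      (zero_le_one.trans hC)
      (fun x' => clampPropensity_mem h.overlap_const.2 _ x')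
      (fun j => (hω (n + j)).1) (Real.rpow_nonneg hn'.le _)
      (by have := h.overlap_const.1; positivity) (τ := 2 / n) (by positivity)
      (div_nonneg (by positivity) hW.le) hy
      ((ccdfHat_eq_or (optRadius d β n) (firstSplit Z n ω) a y).imp id fun ⟨i, hi⟩ => by
        rw [funext hi]
        exact g2 i)
      ((hbr y).1.imp (fun ⟨k, hk1, hk2⟩ => ⟨c k, hc k, hk1, hk2, g1 k, g3 k⟩) fun hk => ⟨hk, g0⟩)
      ((hbr y).2.imp (fun ⟨k, hk1, hk2⟩ => ⟨c k, hc k, hk1, hk2, g1 k, g3 k⟩) id)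
    rw [optRadius_rpow hγ] at key
    refine key.trans (arm_error_le (zero_le_one.trans hC) hCα.le hCβ.le hC₀ h.overlap_const hL hV hW
      ?_)
    refine div_le_div_of_nonneg_left zero_le_two hV ?_
    have h1 : (1 : ℝ) ≤ n := by exact_mod_cast hn
    refine (Real.rpow_le_rpow_of_exponent_le h1 ?_).trans_eq (Real.rpow_one _)
    rw [div_le_one (by positivity)]
    have : 0 ≤ d / γ := by positivity
    linarith
  · have h1 : (1 : ENNReal) ≤ n := by exact_mod_cast hn
    push_cast
    calc _ = (1 + n + n + n) * ENNReal.ofReal δ := by ring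
      _ ≤ (n + n + n + n) * ENNReal.ofReal δ := by gcongr
      _ = _ := by ring

end Arm

end NWAssumptions

/-- The constant in the error bound for the contrasting function. -/
noncomputable def contrastConst (C Cα Cβ C₀ : ℝ) : ℝ := 2 * armConst C Cα Cβ C₀ + 9 / √C₀

theorem armConst_pos {C Cα Cβ C₀ : ℝ} (hC : 0 ≤ C) (hCα : 0 ≤ Cα) (hCβ : 0 ≤ Cβ) :
    0 < armConst C Cα Cβ C₀ := by
  unfold armConst
  positivity

theorem contrastConst_pos {C Cα Cβ C₀ : ℝ} (hC : 0 ≤ C) (hCα : 0 ≤ Cα) (hCβ : 0 ≤ Cβ) :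
    0 < contrastConst C Cα Cβ C₀ := by
  have := armConst_pos (C₀ := C₀) hC hCα hCβ
  unfold contrastConst
  positivity

theorem three_div_le {C Cα Cβ C₀ ξ L V E : ℝ} (hC : 0 ≤ C) (hCα : 0 ≤ Cα) (hCβ : 0 ≤ Cβ)
    (hC₀ : 0 < C₀) (hξ : 0 < ξ) (hL : 1 ≤ L) (hE : 0 < E) (hEV : E ≤ V) (h8 : C₀ * V ^ 2 < 8 * L) :
    3 / ξ ≤ contrastConst C Cα Cβ C₀ / ξ * (L / E) := by
  have h0 := armConst_pos (C₀ := C₀) hC hCα hCβ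
  have hs : 0 < √C₀ := Real.sqrt_pos.2 hC₀
  have h1 : √C₀ * V ≤ 3 * L := by
    refine abs_le_of_sq_le_sq' ?_ (by positivity) |>.2
    rw [mul_pow, Real.sq_sqrt hC₀.le]
    nlinarith
  have h2 : 3 ≤ 9 / √C₀ * (L / E) := by
    rw [div_mul_div_comm, le_div_iff₀ (by positivity)]
    nlinarith
  have h3 : 9 / √C₀ ≤ contrastConst C Cα Cβ C₀ := by
    unfold contrastConst
    linarith
  calc 3 / ξ ≤ 9 / √C₀ * (L / E) / ξ := by gcongr
    _ ≤ contrastConst C Cα Cβ C₀ * (L / E) / ξ := by gcongr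
    _ = _ := by ring

theorem abs_sub_sub_le_contrastConst {C Cα Cβ C₀ ξ L E u u' v v' : ℝ} (hL : 0 ≤ L) (hE : 0 < E)
    (hξ : 0 < ξ) (hu : |u - v| ≤ armConst C Cα Cβ C₀ / ξ * (L / E))
    (hu' : |u' - v'| ≤ armConst C Cα Cβ C₀ / ξ * (L / E)) :
    |u - u' - (v - v')| ≤ contrastConst C Cα Cβ C₀ / ξ * (L / E) := by
  have h1 : contrastConst C Cα Cβ C₀ / ξ * (L / E) = armConst C Cα Cβ C₀ / ξ * (L / E) +
      armConst C Cα Cβ C₀ / ξ * (L / E) + 9 / √C₀ / ξ * (L / E) := by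
    unfold contrastConst
    ring
  have h2 : 0 ≤ 9 / √C₀ / ξ * (L / E) := by positivity
  rw [h1]
  have := abs_le.1 hu
  have := abs_le.1 hu'
  exact abs_le.2 ⟨by linarith, by linarith⟩

theorem contrastRate_pos {d n : ℕ} {α β γ : ℝ} (hn : 1 ≤ n) : 0 < contrastRate d α β γ n := by
  have hn' : (0 : ℝ) < n := by exact_mod_cast hn
  exact lt_min (Real.rpow_pos_of_pos hn' _) (Real.rpow_pos_of_pos hn' _)

theorem one_le_log_one_div {δ : ℝ} (hδ : δ ∈ Set.Ioo 0 (Real.exp (-1))) :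
    1 ≤ Real.log (1 / δ) := by
  rw [one_div, Real.log_inv]
  have := (Real.log_lt_iff_lt_exp hδ.1).2 hδ.2
  linarith

theorem log_le_three_of_le_sixteen {c : ℝ} (hc : 0 < c) (h : c ≤ 16) : Real.log c ≤ 3 := by
  rw [Real.log_le_iff_le_exp hc]
  have h1 := Real.exp_one_gt_d9
  have h2 : Real.exp 3 = Real.exp 1 ^ 3 := by
    rw [← Real.exp_nat_mul]
    norm_num
  have h3 : (2.7182818283 : ℝ) ^ 3 ≤ Real.exp 1 ^ 3 := pow_le_pow_left₀ (by norm_num) h1.le 3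
  rw [h2]
  norm_num at h3
  linarith

namespace NWAssumptions

variable {d : ℕ} {M : CausalModel d} {𝒳 : Set (Cov d)} {𝒴 : Set ℝ} {x : Cov d} {Ω : Type*}
  [MeasurableSpace Ω] {P : Measure Ω} {Z : ℕ → Ω → Obs d}
  {piHat : (n : ℕ) → (Fin n → Obs d) → Cov d → ℝ} {α β γ ξ C Cα Cβ C₀ C₂ : ℝ}

theorem ae_contrastHat_eq (h : NWAssumptions M 𝒳 𝒴 x P Z piHat α β γ ξ C Cα Cβ C₀ C₂) (n : ℕ) :
    ∀ᵐ ω ∂P, ∀ y₀ y₁, contrastHat (optRadius d γ n) (optRadius d β n) (piHat n (firstSplit Z n ω))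
      (firstSplit Z n ω) (secondSplit Z n ω) y₀ y₁ x =
        sampleArmHat Z piHat β γ ξ n x true y₁ ω - sampleArmHat Z piHat β γ ξ n x false y₀ ω := by
  obtain ⟨hξ0, hξ2⟩ := h.overlap_const
  filter_upwards [h.ae_data_mem, h.overlap_hat n] with ω hω hov y₀ y₁
  rw [contrastHat_congr (q := clampPropensity ξ (piHat n (firstSplit Z n ω))) _ _
    (firstSplit Z n ω) (secondSplit Z n ω) _ _ _
    fun j => (clampPropensity_eq (hov _ (hω (n + j)).1)).symm]
  refine contrastHat_eq_sub _ _ _ _ _ _ _ fun j => ?_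
  have := clampPropensity_mem hξ2 (piHat n (firstSplit Z n ω)) (secondSplit Z n ω j).2.1
  exact ⟨hξ0.trans_le this.1, by linarith [this.2]⟩

theorem abs_sampleArmHat_sub_sub_contrast_le
    (h : NWAssumptions M 𝒳 𝒴 x P Z piHat α β γ ξ C Cα Cβ C₀ C₂) (n : ℕ) (y₀ y₁ : ℝ) (ω : Ω) :
    |sampleArmHat Z piHat β γ ξ n x true y₁ ω - sampleArmHat Z piHat β γ ξ n x false y₀ ω -
      M.contrast y₀ y₁ x| ≤ 3 / ξ := by
  obtain ⟨hξ0, hξ2⟩ := h.overlap_const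
  have hb : ∀ a y, |sampleArmHat Z piHat β γ ξ n x a y ω| ≤ 1 / ξ := fun a y =>
    abs_armHat_le _ _ _ _ _ _ _ h.overlap_const fun j => clampPropensity_mem hξ2 _ _
  have hc : ∀ a y, M.ccdf a y x ∈ Set.Icc (0 : ℝ) 1 := fun a y =>
    ⟨measureReal_nonneg, measureReal_le_one⟩
  have hξ1 : 1 ≤ 1 / ξ := by
    rw [le_div_iff₀ hξ0]
    linarith
  have h3 : 3 / ξ = 1 / ξ + 1 / ξ + 1 / ξ := by ring
  have h1 := abs_le.1 (hb true y₁)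
  have h2 := abs_le.1 (hb false y₀)
  have c1 := hc true y₁
  have c2 := hc false y₀
  unfold CausalModel.contrast
  exact abs_le.2 ⟨by linarith [c1.1, c1.2, c2.1, c2.2], by linarith [c1.1, c1.2, c2.1, c2.2]⟩

theorem eventually_le_mul_measureReal_closedBall
    (h : NWAssumptions M 𝒳 𝒴 x P Z piHat α β γ ξ C Cα Cβ C₀ C₂) :
    ∀ᶠ n : ℕ in atTop, 1 ≤ n ∧ C₀ * ((n : ℝ) ^ (1 / (2 + d / γ))) ^ 2 ≤
      n * M.covLaw.real (Metric.closedBall x (optRadius d γ n)) := by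
  obtain ⟨c, r₀, hr₀, hcx, hball, -⟩ := h.small_ball
  filter_upwards [eventually_ge_atTop 1,
    (tendsto_optRadius (d := d) h.smoothness_γ.1).eventually_lt_const hr₀] with n hn hlt
  have hn' : (0 : ℝ) < n := by exact_mod_cast hn
  have hb := (hball x h.mem_covariates).2 (optRadius d γ n) ⟨Real.rpow_pos_of_pos hn' _, hlt⟩
  rw [hcx] at hb
  refine ⟨hn, ?_⟩
  rw [← mul_optRadius_pow h.smoothness_γ.1 hn, mul_left_comm]
  exact mul_le_mul_of_nonneg_left hb hn'.le

variable [IsProbabilityMeasure P]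

/-- Pointwise accuracy of the estimate of the contrasting function. -/
theorem eventually_measure_contrastHat_le
    (h : NWAssumptions M 𝒳 𝒴 x P Z piHat α β γ ξ C Cα Cβ C₀ C₂) (hC : 1 ≤ C) (hCα : 0 < Cα)
    (hCβ : 0 < Cβ) (hC₀ : 0 < C₀) :
    ∀ᶠ n : ℕ in atTop, ∀ δ ∈ Set.Ioo (0 : ℝ) (Real.exp (-1)), ∀ y₀ ∈ 𝒴, ∀ y₁ ∈ 𝒴,
      P {ω | ¬ |contrastHat (optRadius d γ n) (optRadius d β n) (piHat n (firstSplit Z n ω))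
          (firstSplit Z n ω) (secondSplit Z n ω) y₀ y₁ x - M.contrast y₀ y₁ x| ≤
        contrastConst C Cα Cβ C₀ / ξ * (Real.log (1 / δ) / contrastRate d α β γ n)} ≤
      ENNReal.ofReal δ := by
  filter_upwards [h.eventually_le_mul_measureReal_closedBall] with n hn δ hδ y₀ hy₀ y₁ hy₁
  obtain ⟨hn, hball⟩ := hn
  have hE := contrastRate_pos (d := d) (α := α) (β := β) (γ := γ) hn
  have hξ0 := h.overlap_const.1
  set L := Real.log (1 / δ) with hLdef
  have hL : 1 ≤ L := one_le_log_one_div hδ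
  by_cases h8 : 8 * L ≤ C₀ * ((n : ℝ) ^ (1 / (2 + d / γ))) ^ 2
  · have hδ' : δ / 6 ∈ Set.Ioo 0 (Real.exp (-1)) :=
      ⟨by linarith [hδ.1], by linarith [hδ.1, hδ.2]⟩
    have hlog : Real.log (2 / (δ / 6)) ≤ 4 * L := by
      have : 2 / (δ / 6) = 12 * (1 / δ) := by
        field_simp
        norm_num
      rw [this, Real.log_mul (by norm_num) (by have := hδ.1; positivity)]
      linarith [log_le_three_of_le_sixteen (c := 12) (by norm_num) (by norm_num)]
    have e1 := h.measure_not_abs_sampleArmHat_le hC hCα hCβ hC₀ hn hball hL h8 hδ' hlog true hy₁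
    have e0 := h.measure_not_abs_sampleArmHat_le hC hCα hCβ hC₀ hn hball hL h8 hδ' hlog false hy₀
    refine le_trans (measure_mono_ae ?_)
      (((measure_union_le _ _).trans (add_le_add e1 e0)).trans ?_)
    · filter_upwards [h.ae_contrastHat_eq n] with ω hω hbad
      by_contra hgood
      refine hbad ?_
      rw [hω]
      have g1 : |sampleArmHat Z piHat β γ ξ n x true y₁ ω - M.ccdf true y₁ x| ≤ _ :=
        not_not.1 fun hh => hgood (Or.inl hh)
      have g0 : |sampleArmHat Z piHat β γ ξ n x false y₀ ω - M.ccdf false y₀ x| ≤ _ :=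
        not_not.1 fun hh => hgood (Or.inr hh)
      exact abs_sub_sub_le_contrastConst (zero_le_one.trans hL) hE hξ0 g1 g0
    · rw [show (3 : ENNReal) = ENNReal.ofReal 3 by simp, ← ENNReal.ofReal_mul (by norm_num),
        ← ENNReal.ofReal_add (by linarith [hδ.1]) (by linarith [hδ.1])]
      exact ENNReal.ofReal_le_ofReal (by linarith)
  · refine (le_of_eq (measure_mono_null_ae ?_ (measure_empty (μ := P)))).trans zero_le
    filter_upwards [h.ae_contrastHat_eq n] with ω hω hbad
    refine hbad ?_
    rw [hω]
    exact (h.abs_sampleArmHat_sub_sub_contrast_le n y₀ y₁ ω).trans 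
      (three_div_le (zero_le_one.trans hC) hCα.le hCβ.le hC₀ hξ0 hL hE (min_le_left _ _)
        (not_le.1 h8))

/-- Uniform accuracy of the estimate of the contrasting function. -/
theorem eventually_measure_forall_contrastHat_le
    (h : NWAssumptions M 𝒳 𝒴 x P Z piHat α β γ ξ C Cα Cβ C₀ C₂) (hC : 1 ≤ C) (hCα : 0 < Cα)
    (hCβ : 0 < Cβ) (hC₀ : 0 < C₀) :
    ∀ᶠ n : ℕ in atTop, ∀ δ ∈ Set.Ioo (0 : ℝ) (Real.exp (-1)),
      P {ω | ¬ ∀ y₀ ∈ 𝒴, ∀ y₁ ∈ 𝒴,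
        |contrastHat (optRadius d γ n) (optRadius d β n) (piHat n (firstSplit Z n ω))
          (firstSplit Z n ω) (secondSplit Z n ω) y₀ y₁ x - M.contrast y₀ y₁ x| ≤
        contrastConst C Cα Cβ C₀ / ξ * (Real.log (n / δ) / contrastRate d α β γ n)} ≤
      ENNReal.ofReal δ := by
  filter_upwards [h.eventually_le_mul_measureReal_closedBall] with n hn δ hδ
  obtain ⟨hn, hball⟩ := hn
  have hn1 : (1 : ℝ) ≤ n := by exact_mod_cast hn
  have hn' : (0 : ℝ) < n := by linarith
  have hδ0 := hδ.1
  have hE := contrastRate_pos (d := d) (α := α) (β := β) (γ := γ) hn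
  have hξ0 := h.overlap_const.1
  set L := Real.log (n / δ) with hLdef
  have hL : 1 ≤ L := (one_le_log_one_div hδ).trans (Real.log_le_log (by positivity) (by gcongr))
  by_cases h8 : 8 * L ≤ C₀ * ((n : ℝ) ^ (1 / (2 + d / γ))) ^ 2
  · have hδ' : δ / (8 * n) ∈ Set.Ioo 0 (Real.exp (-1)) :=
      ⟨by positivity, (div_le_self hδ0.le (by linarith)).trans_lt hδ.2⟩
    have hlog : Real.log (2 / (δ / (8 * n))) ≤ 4 * L := by
      have : 2 / (δ / (8 * n)) = 16 * (n / δ) := by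
        field_simp
        norm_num
      rw [this, Real.log_mul (by norm_num) (by positivity)]
      linarith [log_le_three_of_le_sixteen (c := 16) (by norm_num) (by norm_num)]
    have e := h.measure_not_forall_abs_sampleArmHat_le hC hCα hCβ hC₀ hn hball hL h8 hδ' hlog
    refine le_trans (measure_mono_ae ?_)
      (((measure_union_le _ _).trans (add_le_add (e true) (e false))).trans ?_)
    · filter_upwards [h.ae_contrastHat_eq n] with ω hω hbad
      by_contra hgood
      refine hbad fun y₀ hy₀ y₁ hy₁ => ?_
      rw [hω]
      have g1 : ∀ y ∈ 𝒴, |sampleArmHat Z piHat β γ ξ n x true y ω - M.ccdf true y x| ≤ _ :=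
        not_not.1 fun hh => hgood (Or.inl hh)
      have g0 : ∀ y ∈ 𝒴, |sampleArmHat Z piHat β γ ξ n x false y ω - M.ccdf false y x| ≤ _ :=
        not_not.1 fun hh => hgood (Or.inr hh)
      exact abs_sub_sub_le_contrastConst (zero_le_one.trans hL) hE hξ0 (g1 y₁ hy₁) (g0 y₀ hy₀)
    · rw [← ENNReal.ofReal_natCast, ← ENNReal.ofReal_mul (by positivity),
        ← ENNReal.ofReal_add (by positivity) (by positivity)]
      refine ENNReal.ofReal_le_ofReal (le_of_eq ?_)
      push_cast
      field_simp
      norm_num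
  · refine (le_of_eq (measure_mono_null_ae ?_ (measure_empty (μ := P)))).trans zero_le
    filter_upwards [h.ae_contrastHat_eq n] with ω hω hbad
    refine hbad fun y₀ _ y₁ _ => ?_
    rw [hω]
    exact (h.abs_sampleArmHat_sub_sub_contrast_le n y₀ y₁ ω).trans
      (three_div_le (zero_le_one.trans hC) hCα.le hCβ.le hC₀ hξ0 hL hE (min_le_left _ _)
        (not_le.1 h8))

end NWAssumptions

section Inversion

variable {d n : ℕ}

theorem mem_evalPoints {D₁ D₂ : Fin n → Obs d} {q : ℝ} :
    q ∈ evalPoints D₁ D₂ ↔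
      (∃ i, (D₁ i).2.2 = true ∧ (D₁ i).1 = q) ∨ ∃ i, (D₂ i).2.2 = true ∧ (D₂ i).1 = q := by
  simp only [evalPoints, List.mem_insertionSort, List.mem_map, List.mem_filter, List.mem_append,
    List.mem_ofFn]
  constructor
  · rintro ⟨z, ⟨⟨i, rfl⟩ | ⟨i, rfl⟩, hz⟩, rfl⟩
    · exact Or.inl ⟨i, hz, rfl⟩
    · exact Or.inr ⟨i, hz, rfl⟩
  · rintro (⟨i, hz, rfl⟩ | ⟨i, hz, rfl⟩)
    · exact ⟨_, ⟨Or.inl ⟨i, rfl⟩, hz⟩, rfl⟩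
    · exact ⟨_, ⟨Or.inr ⟨i, rfl⟩, hz⟩, rfl⟩

/-- The estimated contrasting function is constant between consecutive evaluation points. -/
theorem contrastHat_eq_of_forall_evalPoints (rh rF : ℝ) (p : Cov d → ℝ) {D₁ D₂ : Fin n → Obs d}
    (y : ℝ) (x : Cov d) {u v : ℝ} (h : ∀ q ∈ evalPoints D₁ D₂, q ≤ u ↔ q ≤ v) :
    contrastHat rh rF p D₁ D₂ y u x = contrastHat rh rF p D₁ D₂ y v x := by
  have hF : ∀ x', ccdfHat rF D₁ true u x' = ccdfHat rF D₁ true v x' := fun x' => by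
    refine Finset.sum_congr rfl fun i _ => ?_
    by_cases hi : (D₁ i).2.2 = true
    · rw [if_congr (h _ (mem_evalPoints.2 (Or.inl ⟨i, hi, rfl⟩))) rfl rfl]
    · simp [hi]
  refine Finset.sum_congr rfl fun j _ => ?_
  simp only [pseudoOutcome, hF]
  by_cases hj : (D₂ j).2.2 = true
  · simp only [hj, if_true, hF]
    rw [if_congr (h _ (mem_evalPoints.2 (Or.inr ⟨j, hj, rfl⟩))) rfl rfl]
  · simp [hj]

theorem cqcHat_mem (rh rF : ℝ) (p : Cov d → ℝ) (D₁ D₂ : Fin n → Obs d) (y : ℝ) (x : Cov d) :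
    cqcHat rh rF p D₁ D₂ y x ∈ evalPoints D₁ D₂ ∨ cqcHat rh rF p D₁ D₂ y x = y := by
  unfold cqcHat
  simp only
  split_ifs
  · exact Or.inl (List.get_mem _ _)
  · exact Or.inr rfl

/-- The error of the estimated comparator on the scale of the cdf `F`. -/
theorem abs_cdf_cqcHat_sub_le (rh rF : ℝ) (p : Cov d → ℝ) {D₁ D₂ : Fin n → Obs d} {y : ℝ}
    {x : Cov d} {F : ℝ → ℝ} (hF : Monotone F) {c ε u v : ℝ}
    (hpts : ∀ q ∈ evalPoints D₁ D₂, |contrastHat rh rF p D₁ D₂ y q x - (F q - c)| ≤ ε)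
    (hu : |contrastHat rh rF p D₁ D₂ y u x - (F u - c)| ≤ ε)
    (hv : |contrastHat rh rF p D₁ D₂ y v x - (F v - c)| ≤ ε)
    (huv : 2 * ε < F v - F u) (huc : |F u - c| ≤ 3 * ε) (hvc : |F v - c| ≤ 3 * ε) :
    |F (cqcHat rh rF p D₁ D₂ y x) - c| ≤ 5 * ε := by
  have hε : 0 ≤ ε := (abs_nonneg _).trans hu
  obtain ⟨q, hq, huq, hqv⟩ : ∃ q ∈ evalPoints D₁ D₂, u < q ∧ q ≤ v := by
    by_contra! hno
    have huv' : u ≤ v := by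
      by_contra! hlt
      linarith [hF hlt.le]
    have := contrastHat_eq_of_forall_evalPoints rh rF p (D₁ := D₁) (D₂ := D₂) y x (u := u) (v := v)
      fun q hq => ⟨fun hqu => hqu.trans huv', fun hqv => by
        by_contra! hlt
        exact absurd hqv (not_le.2 (hno q hq hlt))⟩
    rw [this] at hu
    linarith [(abs_le.1 hu).2, (abs_le.1 hv).1]
  set pts := evalPoints D₁ D₂
  obtain ⟨l, hlq⟩ := List.mem_iff_get.1 hq
  set w := isotonicProj fun l : Fin pts.length => contrastHat rh rF p D₁ D₂ y (pts.get l) x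
  have hmono : Monotone fun l : Fin pts.length => F (pts.get l) - c := fun i j hij => by
    have hs : pts.SortedLE := (List.pairwise_insertionSort (· ≤ ·) _).sortedLE
    have := hF (hs.monotone_get hij)
    simp only
    linarith
  have hiso : ∀ i, |w i - (F (pts.get i) - c)| ≤ ε := fun i =>
    abs_isotonicProj_sub_le hmono (fun i => hpts _ (List.get_mem _ _)) i
  have hne : (absMinimisers w).Nonempty := by
    obtain ⟨m, -, hm⟩ := Finset.exists_min_image Finset.univ (fun i => |w i|) ⟨l, Finset.mem_univ l⟩
    exact ⟨m, by simpa [absMinimisers] using fun i => hm i (Finset.mem_univ i)⟩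
  have hcqc : cqcHat rh rF p D₁ D₂ y x = pts.get ((absMinimisers w).min' hne) := by
    unfold cqcHat
    exact dif_pos hne
  rw [hcqc]
  have hmin := Finset.min'_mem _ hne
  set m := (absMinimisers w).min' hne
  have hml : |w m| ≤ |w l| := by
    have : ∀ i, |w m| ≤ |w i| := by simpa [absMinimisers] using hmin
    exact this l
  have hl : |F (pts.get l) - c| ≤ 3 * ε := by
    rw [hlq]
    have h1 := hF huq.le
    have h2 := hF hqv
    exact abs_le.2 ⟨by linarith [(abs_le.1 huc).1], by linarith [(abs_le.1 hvc).2]⟩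
  have h1 : |w l| ≤ 4 * ε := by
    have := abs_le.1 (hiso l)
    have := abs_le.1 hl
    exact abs_le.2 ⟨by linarith, by linarith⟩
  have h2 := abs_le.1 (hml.trans h1)
  have h3 := abs_le.1 (hiso m)
  exact abs_le.2 ⟨by linarith, by linarith⟩

end Inversion

/-- Two points of a set of full measure whose cdf values are close to, and separated as needed for
the localisation of, the cdf value at `c`. -/
theorem exists_separated_cdf {ν : Measure ℝ} [IsProbabilityMeasure ν] [NullSingletonClass ν]
    {s : Set ℝ} (hs : ν sᶜ = 0) {g ε : ℝ} (hg : g ∈ s) (hε : 0 < ε) (hε6 : ε ≤ 1 / 6) :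
    ∃ u ∈ s, ∃ v ∈ s, 2 * ε < ν.real (Set.Iic v) - ν.real (Set.Iic u) ∧
      |ν.real (Set.Iic u) - ν.real (Set.Iic g)| ≤ 3 * ε ∧
      |ν.real (Set.Iic v) - ν.real (Set.Iic g)| ≤ 3 * ε := by
  have h0 : 0 ≤ ν.real (Set.Iic g) := measureReal_nonneg
  rcases le_or_gt (ν.real (Set.Iic g) + 3 * ε) 1 with h1 | h1
  · obtain ⟨v, hv, hv1, hv2⟩ := exists_mem_cdf_mem_Ioo hs
      (a := ν.real (Set.Iic g) + 2 * ε) (b := ν.real (Set.Iic g) + 3 * ε) (by linarith)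
      (by linarith) h1
    exact ⟨g, hg, v, hv, by linarith, by simpa using hε.le,
      abs_le.2 ⟨by linarith, by linarith⟩⟩
  · have h2 : ν.real (Set.Iic g) ≤ 1 := measureReal_le_one
    obtain ⟨u, hu, hu1, hu2⟩ := exists_mem_cdf_mem_Ioo hs
      (a := ν.real (Set.Iic g) - 3 * ε) (b := ν.real (Set.Iic g) - 2 * ε) (by linarith)
      (by linarith) (by linarith)
    exact ⟨u, hu, g, hg, by linarith, abs_le.2 ⟨by linarith, by linarith⟩, by simpa using hε.le⟩

theorem rpow_three_halves {L : ℝ} (hL : 0 ≤ L) : L ^ (3 / 2 : ℝ) = L * √L := by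
  rw [show (3 / 2 : ℝ) = 1 + 1 / 2 by norm_num,
    Real.rpow_add_of_nonneg hL (by norm_num) (by norm_num),
    Real.rpow_one, Real.sqrt_eq_rpow]

theorem one_le_contrastRate {d n : ℕ} {α β γ : ℝ} (hα : 0 < α) (hβ : 0 < β) (hγ : 0 < γ)
    (hn : 1 ≤ n) : 1 ≤ contrastRate d α β γ n := by
  have h1 : (1 : ℝ) ≤ n := by exact_mod_cast hn
  exact le_min (Real.one_le_rpow h1 (by positivity)) (Real.one_le_rpow h1 (by positivity))

theorem tendsto_log_div_rpow {a δ : ℝ} (ha : 0 < a) (hδ : 0 < δ) :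
    Tendsto (fun n : ℕ => Real.log (n / δ) / (n : ℝ) ^ a) atTop (𝓝 0) := by
  have h1 : Tendsto (fun t : ℝ => Real.log t / t ^ a) atTop (𝓝 0) :=
    (isLittleO_log_rpow_atTop ha).tendsto_div_nhds_zero
  have h2 : Tendsto (fun t : ℝ => Real.log δ / t ^ a) atTop (𝓝 0) :=
    (tendsto_rpow_atTop ha).const_div_atTop _
  have h3 := (h1.sub h2).comp tendsto_natCast_atTop_atTop
  rw [sub_zero] at h3
  refine h3.congr' ?_
  filter_upwards [eventually_ge_atTop 1] with n hn
  have hn' : (n : ℝ) ≠ 0 := by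
    have : n ≠ 0 := by omega
    exact_mod_cast this
  simp only [Function.comp_apply]
  rw [Real.log_div hn' hδ.ne', sub_div]

theorem tendsto_log_div_contrastRate {d : ℕ} {α β γ δ : ℝ} (hα : 0 < α) (hβ : 0 < β) (hγ : 0 < γ)
    (hδ : δ ∈ Set.Ioo (0 : ℝ) (Real.exp (-1))) :
    Tendsto (fun n : ℕ => Real.log (n / δ) / contrastRate d α β γ n) atTop (𝓝 0) := by
  have h := (tendsto_log_div_rpow (a := 1 / (2 + d / γ)) (by positivity) hδ.1).add
    (tendsto_log_div_rpow (a := 1 / (2 + d / α) + 1 / (2 + d / β)) (by positivity) hδ.1)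
  rw [add_zero] at h
  have hlog : ∀ n : ℕ, 1 ≤ n → 0 ≤ Real.log (n / δ) := fun n hn => Real.log_nonneg (by
    have h1 : (1 : ℝ) ≤ n := by exact_mod_cast hn
    rw [le_div_iff₀ hδ.1, one_mul]
    exact (hδ.2.le.trans (Real.exp_le_one_iff.2 (by norm_num))).trans h1)
  refine squeeze_zero' ?_ ?_ h
  · filter_upwards [eventually_ge_atTop 1] with n hn
    exact div_nonneg (hlog n hn) (contrastRate_pos hn).le
  · filter_upwards [eventually_ge_atTop 1] with n hn
    have hn' : (0 : ℝ) < n := by exact_mod_cast hn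
    have hl := hlog n hn
    have p1 : 0 ≤ Real.log (n / δ) / (n : ℝ) ^ (1 / (2 + d / γ)) :=
      div_nonneg hl (Real.rpow_nonneg hn'.le _)
    have p2 : 0 ≤ Real.log (n / δ) / (n : ℝ) ^ (1 / (2 + d / α) + 1 / (2 + d / β)) :=
      div_nonneg hl (Real.rpow_nonneg hn'.le _)
    unfold contrastRate
    rcases min_choice ((n : ℝ) ^ (1 / (2 + d / γ)))
      ((n : ℝ) ^ (1 / (2 + d / α) + 1 / (2 + d / β))) with hm | hm <;> rw [hm] <;> linarith

theorem eventually_le_sqrt_log (A : ℝ) : ∀ᶠ n : ℕ in atTop, A ≤ √(Real.log n) :=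
  (Real.tendsto_sqrt_atTop.comp (Real.tendsto_log_atTop.comp
    tendsto_natCast_atTop_atTop)).eventually_ge_atTop A

theorem CausalModel.untreatedLaw_univ_le {d : ℕ} (M : CausalModel d) :
    M.untreatedLaw Set.univ ≤ 1 := by
  unfold CausalModel.untreatedLaw
  have hs : MeasurableSet {z : Obs d | z.2.2 = false} :=
    measurable_snd.snd (measurableSet_singleton false)
  rw [Measure.map_apply measurable_fst MeasurableSet.univ, cond_apply hs]
  simp only [Set.preimage_univ, Set.inter_univ]
  exact ENNReal.inv_mul_le_one _

section Responses

variable {d : ℕ} {𝒳 : Set (Cov d)} {𝒴 : Set ℝ} {Ω : Type*} {Z : ℕ → Ω → Obs d}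

theorem mem_responses_of_mem_evalPoints {n : ℕ} {ω : Ω}
    (hω : ∀ i, (Z i ω).2.1 ∈ 𝒳 ∧ (Z i ω).1 ∈ 𝒴) {q : ℝ}
    (hq : q ∈ evalPoints (firstSplit Z n ω) (secondSplit Z n ω)) : q ∈ 𝒴 := by
  rcases mem_evalPoints.1 hq with ⟨i, -, rfl⟩ | ⟨i, -, rfl⟩
  · exact (hω i).2
  · exact (hω (n + i)).2

theorem cqcHat_mem_responses {n : ℕ} {ω : Ω} (hω : ∀ i, (Z i ω).2.1 ∈ 𝒳 ∧ (Z i ω).1 ∈ 𝒴) {y : ℝ}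
    (hy : y ∈ 𝒴) (rh rF : ℝ) (p : Cov d → ℝ) (x : Cov d) :
    cqcHat rh rF p (firstSplit Z n ω) (secondSplit Z n ω) y x ∈ 𝒴 := by
  rcases cqcHat_mem rh rF p (firstSplit Z n ω) (secondSplit Z n ω) y x with hm | hm
  · exact mem_responses_of_mem_evalPoints hω hm
  · rwa [hm]

end Responses

namespace NWAssumptions

variable {d : ℕ} {M : CausalModel d} {𝒳 : Set (Cov d)} {𝒴 : Set ℝ} {x : Cov d} {Ω : Type*}
  [MeasurableSpace Ω] {P : Measure Ω} {Z : ℕ → Ω → Obs d}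
  {piHat : (n : ℕ) → (Fin n → Obs d) → Cov d → ℝ} {α β γ ξ C Cα Cβ C₀ C₂ : ℝ}
  {g : ℝ → Cov d → ℝ}

/-- Uniform accuracy of the estimated contrasting function gives accuracy of the estimated
comparator on the scale of the treated cdf. -/
theorem abs_ccdf_cqcHat_sub_le (h : NWAssumptions M 𝒳 𝒴 x P Z piHat α β γ ξ C Cα Cβ C₀ C₂)
    (hg : M.IsCQC 𝒴 𝒳 g) {n : ℕ} {ω : Ω} (hω : ∀ i, (Z i ω).2.1 ∈ 𝒳 ∧ (Z i ω).1 ∈ 𝒴) {ε : ℝ}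
    (hε : 0 < ε) (hε6 : ε ≤ 1 / 6) {y : ℝ} (hy : y ∈ 𝒴) {rh rF : ℝ} {p : Cov d → ℝ}
    (hgood : ∀ y₁ ∈ 𝒴, |contrastHat rh rF p (firstSplit Z n ω) (secondSplit Z n ω) y y₁ x -
      M.contrast y y₁ x| ≤ ε) :
    |M.ccdf true (cqcHat rh rF p (firstSplit Z n ω) (secondSplit Z n ω) y x) x -
      M.ccdf true (g y x) x| ≤ 5 * ε := by
  have := h.noAtoms true h.mem_covariates
  obtain ⟨hgy, hgF⟩ := hg.2 y hy x h.mem_covariates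
  obtain ⟨u, hu, v, hv, huv, huc, hvc⟩ :=
    exists_separated_cdf (h.outcome_compl true x h.mem_covariates) hgy hε hε6
  have hgood' : ∀ y₁ ∈ 𝒴, |contrastHat rh rF p (firstSplit Z n ω) (secondSplit Z n ω) y y₁ x -
      (M.ccdf true y₁ x - M.ccdf true (g y x) x)| ≤ ε := fun y₁ hy₁ => by
    rw [hgF]
    exact hgood y₁ hy₁
  exact abs_cdf_cqcHat_sub_le rh rF p (F := fun y₁ => M.ccdf true y₁ x) measureReal_Iic_mono
    (fun q hq => hgood' q (mem_responses_of_mem_evalPoints hω hq)) (hgood' u hu)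
    (hgood' v hv) huv huc hvc

theorem ae_untreatedLaw_mem (h : NWAssumptions M 𝒳 𝒴 x P Z piHat α β γ ξ C Cα Cβ C₀ C₂) :
    ∀ᵐ y ∂M.untreatedLaw, y ∈ 𝒴 := by
  unfold CausalModel.untreatedLaw
  refine (ae_map_iff measurable_fst.aemeasurable h.measurableSet_responses).2 ?_
  exact cond_absolutelyContinuous.ae_le (h.ae_mem_covariates.mono fun z hz => hz.2)

variable [IsProbabilityMeasure P]

/-- Accuracy of the estimated comparator at one point. -/
theorem eventually_measure_cqcHat_le (h : NWAssumptions M 𝒳 𝒴 x P Z piHat α β γ ξ C Cα Cβ C₀ C₂)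
    (hg : M.IsCQC 𝒴 𝒳 g) (hC : 1 ≤ C) (hCα : 0 < Cα) (hCβ : 0 < Cβ) (hC₀ : 0 < C₀) {y : ℝ}
    (hy : y ∈ 𝒴) {s η : ℝ} (hs : 0 < s) (hη : 0 < η)
    (hdens : ∀ᵐ y' ∂volume, y' ∈ Metric.ball (g y x) s →
      ENNReal.ofReal η ≤ M.treatedDensity x y') {δ : ℝ} (hδ : δ ∈ Set.Ioo (0 : ℝ) (Real.exp (-1))) :
    ∀ᶠ n : ℕ in atTop, P {ω | ¬ |cqcHat (optRadius d γ n) (optRadius d β n)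
        (piHat n (firstSplit Z n ω)) (firstSplit Z n ω) (secondSplit Z n ω) y x - g y x| ≤
      1 / (ξ * η) * (Real.log (n / δ) ^ (3 / 2 : ℝ) / contrastRate d α β γ n)} ≤
      ENNReal.ofReal δ := by
  set K := contrastConst C Cα Cβ C₀
  have hK : 0 < K := contrastConst_pos (zero_le_one.trans hC) hCα.le hCβ.le
  have hξ0 := h.overlap_const.1
  have hlim := (tendsto_log_div_contrastRate (d := d) h.smoothness_α h.smoothness_β
    h.smoothness_γ.1 hδ).const_mul (K / ξ)
  rw [mul_zero] at hlim
  filter_upwards [h.eventually_measure_forall_contrastHat_le hC hCα hCβ hC₀,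
    hlim.eventually_le_const (by norm_num : (0 : ℝ) < 1 / 6),
    hlim.eventually_lt_const (by positivity : (0 : ℝ) < η * (s / 2) / 5),
    eventually_le_sqrt_log (5 * K), eventually_ge_atTop 1] with n hP hε6 hεs hlogn hn
  refine (measure_mono_ae ?_).trans (hP δ hδ)
  filter_upwards [h.ae_data_mem] with ω hω hbad hgood
  refine hbad ?_
  have hn1 : (1 : ℝ) ≤ n := by exact_mod_cast hn
  have hδ0 := hδ.1
  have hE := contrastRate_pos (d := d) (α := α) (β := β) (γ := γ) hn
  set L := Real.log (n / δ) with hLdef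
  set E := contrastRate d α β γ n
  have hL1 : 1 ≤ L := (one_le_log_one_div hδ).trans
    (Real.log_le_log (by positivity) (by gcongr))
  have hnL : Real.log n ≤ L := Real.log_le_log (by linarith) (by
    rw [le_div_iff₀ hδ0]
    exact mul_le_of_le_one_right (by linarith)
      (hδ.2.le.trans (Real.exp_le_one_iff.2 (by norm_num))))
  have hKL : 5 * K ≤ √L := hlogn.trans (Real.sqrt_le_sqrt hnL)
  have hε : 0 < K / ξ * (L / E) := by positivity
  set ε := K / ξ * (L / E) with hεdef
  have key := h.abs_ccdf_cqcHat_sub_le hg hω hε hε6 hy (hgood y hy)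
  set q := cqcHat (optRadius d γ n) (optRadius d β n) (piHat n (firstSplit Z n ω))
    (firstSplit Z n ω) (secondSplit Z n ω) y x
  set G := g y x
  have hinc : ∀ c e, G - s < c → c ≤ e → e < G + s →
      η * (e - c) ≤ M.ccdf true e x - M.ccdf true c x := fun c e hc hce he =>
    mul_sub_le_measureReal_Iic_sub hη.le hce (by
      filter_upwards [hdens] with y' hy' hmem
      refine hy' ?_
      rw [Real.ball_eq_Ioo]
      exact ⟨hc.trans hmem.1, hmem.2.trans he⟩)
  have hmono : Monotone fun y₁ => M.ccdf true y₁ x := measureReal_Iic_mono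
  have hqG : |q - G| ≤ 5 * ε / η := by
    rw [le_div_iff₀ hη]
    have hk := abs_le.1 key
    rcases le_total G q with hGq | hGq
    · rw [abs_of_nonneg (sub_nonneg.2 hGq)]
      have h1 := hinc G (min q (G + s / 2)) (by linarith) (le_min hGq (by linarith))
        ((min_le_right _ _).trans_lt (by linarith))
      have h2 := hmono (min_le_left q (G + s / 2))
      simp only at h2
      have h3 : η * (min q (G + s / 2) - G) < η * (s / 2) := by linarith
      have h4 : min q (G + s / 2) - G < s / 2 := lt_of_mul_lt_mul_left h3 hη.le
      have h5 : min q (G + s / 2) = q := by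
        rcases min_choice q (G + s / 2) with h6 | h6
        · exact h6
        · rw [h6] at h4
          linarith
      rw [h5] at h1
      linarith
    · rw [abs_of_nonpos (sub_nonpos.2 hGq)]
      have h1 := hinc (max q (G - s / 2)) G (lt_of_lt_of_le (by linarith) (le_max_right _ _))
        (max_le hGq (by linarith)) (by linarith)
      have h2 := hmono (le_max_left q (G - s / 2))
      simp only at h2
      have h3 : η * (G - max q (G - s / 2)) < η * (s / 2) := by linarith
      have h4 : G - max q (G - s / 2) < s / 2 := lt_of_mul_lt_mul_left h3 hη.le
      have h5 : max q (G - s / 2) = q := by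
        rcases max_choice q (G - s / 2) with h6 | h6
        · exact h6
        · rw [h6] at h4
          linarith
      rw [h5] at h1
      linarith
  refine hqG.trans ?_
  rw [rpow_three_halves (by linarith)]
  calc 5 * ε / η = 1 / (ξ * η) * (L * (5 * K) / E) := by
        rw [hεdef]
        field_simp
    _ ≤ 1 / (ξ * η) * (L * √L / E) := by gcongr

/-- Accuracy of the estimated comparator in conditional mean. -/
theorem eventually_measure_lintegral_cqcHat_le
    (h : NWAssumptions M 𝒳 𝒴 x P Z piHat α β γ ξ C Cα Cβ C₀ C₂)
    (hg : M.IsCQC 𝒴 𝒳 g) (hC : 1 ≤ C) (hCα : 0 < Cα) (hCβ : 0 < Cβ) (hC₀ : 0 < C₀)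
    {η : ℝ} (hη : 0 < η) (hconn : 𝒴.OrdConnected)
    (hdens : ∀ᵐ y' ∂volume, y' ∈ 𝒴 → ENNReal.ofReal η ≤ M.treatedDensity x y') :
    ∀ᶠ n : ℕ in atTop, ∀ δ ∈ Set.Ioo (0 : ℝ) (Real.exp (-1)),
      P {ω | ¬ ∫⁻ y, ENNReal.ofReal |cqcHat (optRadius d γ n) (optRadius d β n)
          (piHat n (firstSplit Z n ω)) (firstSplit Z n ω) (secondSplit Z n ω) y x - g y x|
            ∂M.untreatedLaw ≤
        ENNReal.ofReal (1 * Metric.diam 𝒴 / (ξ * η) *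
          (Real.log (contrastRate d α β γ n * n / δ) ^ (3 / 2 : ℝ) / contrastRate d α β γ n))} ≤
      ENNReal.ofReal δ := by
  set K := contrastConst C Cα Cβ C₀
  have hK : 0 < K := contrastConst_pos (zero_le_one.trans hC) hCα.le hCβ.le
  have hξ0 := h.overlap_const.1
  have hinc : ∀ c ∈ 𝒴, ∀ e ∈ 𝒴, η * |e - c| ≤ |M.ccdf true e x - M.ccdf true c x| := by
    have hle : ∀ c ∈ 𝒴, ∀ e ∈ 𝒴, c ≤ e → η * (e - c) ≤ M.ccdf true e x - M.ccdf true c x :=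
      fun c hc e he hce => mul_sub_le_measureReal_Iic_sub hη.le hce (by
        filter_upwards [hdens] with y' hy' hmem
        exact hy' (hconn.out hc he (Set.Ioo_subset_Icc_self hmem)))
    intro c hc e he
    rcases le_total c e with hce | hce
    · rw [abs_of_nonneg (sub_nonneg.2 hce)]
      exact (hle c hc e he hce).trans (le_abs_self _)
    · rw [abs_of_nonpos (sub_nonpos.2 hce), abs_sub_comm]
      have := hle e he c hc hce
      rw [neg_sub]
      exact this.trans (le_abs_self _)
  have hF1 : ∀ c e, |M.ccdf true e x - M.ccdf true c x| ≤ 1 := fun c e => by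
    have hc : ∀ y, M.ccdf true y x ∈ Set.Icc (0 : ℝ) 1 := fun y =>
      ⟨measureReal_nonneg, measureReal_le_one⟩
    exact abs_le.2 ⟨by linarith [(hc c).2, (hc e).1], by linarith [(hc c).1, (hc e).2]⟩
  have hbdd : Bornology.IsBounded 𝒴 := Metric.isBounded_iff.2 ⟨1 / η, fun c hc e he => by
    rw [Real.dist_eq, le_div_iff₀ hη, mul_comm, abs_sub_comm]
    exact (hinc c hc e he).trans (hF1 c e)⟩
  have hdist : ∀ c ∈ 𝒴, ∀ e ∈ 𝒴, |e - c| ≤ Metric.diam 𝒴 := fun c hc e he =>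
    Metric.dist_le_diam_of_mem hbdd he hc
  have hdiam : 0 < Metric.diam 𝒴 := by
    have := h.noAtoms true h.mem_covariates
    have hcompl := h.outcome_compl true x h.mem_covariates
    obtain ⟨c, hc, hc1⟩ := exists_mem_cdf_mem_Ioo hcompl (a := 0) (b := 1 / 2) le_rfl
      (by norm_num) (by norm_num)
    obtain ⟨e, he, he1⟩ := exists_mem_cdf_mem_Ioo hcompl (a := 1 / 2) (b := 1) (by norm_num)
      (by norm_num) le_rfl
    have hne : e - c ≠ 0 := fun h0 => by
      rw [sub_eq_zero.1 h0] at he1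
      linarith [hc1.2, he1.1]
    exact (abs_pos.2 hne).trans_le (hdist c hc e he)
  filter_upwards [h.eventually_measure_forall_contrastHat_le hC hCα hCβ hC₀,
    eventually_le_sqrt_log (5 * K / Metric.diam 𝒴), eventually_le_sqrt_log (6 * K * η),
    eventually_ge_atTop 1] with n hP hlog5 hlog6 hn δ hδ
  refine (measure_mono_ae ?_).trans (hP δ hδ)
  filter_upwards [h.ae_data_mem] with ω hω hbad hgood
  refine hbad ?_
  have hn1 : (1 : ℝ) ≤ n := by exact_mod_cast hn
  have hδ0 := hδ.1
  have hδ1 : δ ≤ 1 := hδ.2.le.trans (Real.exp_le_one_iff.2 (by norm_num))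
  have hE1 := one_le_contrastRate (d := d) h.smoothness_α h.smoothness_β h.smoothness_γ.1 hn
  set E := contrastRate d α β γ n
  have hE : 0 < E := by linarith
  set L := Real.log (n / δ)
  set L' := Real.log (E * n / δ)
  have hL1 : 1 ≤ L := (one_le_log_one_div hδ).trans
    (Real.log_le_log (by positivity) (by gcongr))
  have hLL : L ≤ L' := Real.log_le_log (by positivity)
    (by gcongr; exact le_mul_of_one_le_left (by linarith) hE1)
  have hnL : Real.log n ≤ L' := (Real.log_le_log (by linarith) (by
    rw [le_div_iff₀ hδ0]
    exact mul_le_of_le_one_right (by linarith) hδ1)).trans hLL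
  have hL0 : 0 ≤ L' := by linarith
  have h5 : 5 * K ≤ Metric.diam 𝒴 * √L' := by
    have := hlog5.trans (Real.sqrt_le_sqrt hnL)
    rwa [div_le_iff₀' hdiam] at this
  have h6 : 6 * K * η ≤ √L' := hlog6.trans (Real.sqrt_le_sqrt hnL)
  have hε : 0 < K / ξ * (L / E) := by positivity
  have hpt : ∀ y ∈ 𝒴, |cqcHat (optRadius d γ n) (optRadius d β n) (piHat n (firstSplit Z n ω))
      (firstSplit Z n ω) (secondSplit Z n ω) y x - g y x| ≤
        1 * Metric.diam 𝒴 / (ξ * η) * (L' ^ (3 / 2 : ℝ) / E) := by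
    intro y hy
    have hq := cqcHat_mem_responses (n := n) hω hy (optRadius d γ n) (optRadius d β n)
      (piHat n (firstSplit Z n ω)) x
    have hG := (hg.2 y hy x h.mem_covariates).1
    rw [rpow_three_halves (by linarith)]
    rcases le_or_gt (K / ξ * (L / E)) (1 / 6) with hε6 | hε6
    · have key := (hinc _ hG _ hq).trans (h.abs_ccdf_cqcHat_sub_le hg hω hε hε6 hy (hgood y hy))
      rw [mul_comm, ← le_div_iff₀ hη] at key
      refine key.trans ?_
      calc 5 * (K / ξ * (L / E)) / η = 1 / (ξ * η) * (L * (5 * K) / E) := by field_simp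
        _ ≤ 1 / (ξ * η) * (L' * (Metric.diam 𝒴 * √L') / E) := by gcongr
        _ = _ := by ring
    · refine (hdist _ hG _ hq).trans ?_
      have : 1 ≤ 6 * (K / ξ * (L / E)) := by linarith
      calc Metric.diam 𝒴 ≤ Metric.diam 𝒴 * (6 * (K / ξ * (L / E))) :=
            le_mul_of_one_le_right hdiam.le this
        _ = Metric.diam 𝒴 / (ξ * η) * (L * (6 * K * η) / E) := by field_simp
        _ ≤ Metric.diam 𝒴 / (ξ * η) * (L' * √L' / E) := by gcongr
        _ = _ := by ring
  refine (lintegral_mono_ae (h.ae_untreatedLaw_mem.mono fun y hy =>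
    ENNReal.ofReal_le_ofReal (hpt y hy))).trans ?_
  rw [lintegral_const]
  exact mul_le_of_le_one_right zero_le M.untreatedLaw_univ_le

end NWAssumptions

theorem mainTheorem4 (C Cα Cβ C₀ C₂ : ℝ) (hC : 1 ≤ C) (hα : 0 < Cα) (hβ : 0 < Cβ)
    (h₀ : 0 < C₀) (h₂ : 0 < C₂) :
    -- the constants depend on `C, Cα, Cβ, C₀, C₂` only
    ∃ Ch Cg Cg₂ : ℝ, 0 < Ch ∧ 0 < Cg ∧ 0 < Cg₂ ∧
      ∀ (d : ℕ) (M : CausalModel d) (𝒳 : Set (Cov d)) (𝒴 : Set ℝ) (x : Cov d)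
        (Ω : Type*) [MeasurableSpace Ω] (P : Measure Ω) [IsProbabilityMeasure P]
        (Z : ℕ → Ω → Obs d) (piHat : (n : ℕ) → (Fin n → Obs d) → Cov d → ℝ)
        (α β γ ξ : ℝ) (g : ℝ → Cov d → ℝ),
        NWAssumptions M 𝒳 𝒴 x P Z piHat α β γ ξ C Cα Cβ C₀ C₂ →
        M.IsCQC 𝒴 𝒳 g →
        -- accuracy of the estimate of the contrasting function
        (∃ n₀ : ℕ, ∀ n ≥ n₀, ∀ δ ∈ Set.Ioo (0 : ℝ) (Real.exp (-1)), ∀ y₀ ∈ 𝒴, ∀ y₁ ∈ 𝒴,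
          P {ω | ¬ |contrastHat (optRadius d γ n) (optRadius d β n) (piHat n (firstSplit Z n ω))
                (firstSplit Z n ω) (secondSplit Z n ω) y₀ y₁ x - M.contrast y₀ y₁ x|
              ≤ Ch / ξ * (Real.log (1 / δ) ^ (3 / 2 : ℝ) / contrastRate d α β γ n)}
            ≤ ENNReal.ofReal δ) ∧
        -- accuracy of the estimate of the conditional quantile comparator
        (∀ y ∈ 𝒴, ∀ s η : ℝ, 0 < s → 0 < η →
          (∀ᵐ y' ∂volume, y' ∈ Metric.ball (g y x) s →
            ENNReal.ofReal η ≤ M.treatedDensity x y') →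
          ∀ δ ∈ Set.Ioo (0 : ℝ) (Real.exp (-1)), ∃ n₀ : ℕ, ∀ n ≥ n₀,
          P {ω | ¬ |cqcHat (optRadius d γ n) (optRadius d β n) (piHat n (firstSplit Z n ω))
                (firstSplit Z n ω) (secondSplit Z n ω) y x - g y x|
              ≤ Cg / (ξ * η) * (Real.log (n / δ) ^ (3 / 2 : ℝ) / contrastRate d α β γ n)}
            ≤ ENNReal.ofReal δ) ∧
        -- accuracy in conditional mean, given `A = 0` and the estimate
        (∀ η : ℝ, 0 < η → 𝒴.OrdConnected →
          (∀ᵐ y' ∂volume, y' ∈ 𝒴 → ENNReal.ofReal η ≤ M.treatedDensity x y') →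
          ∃ n₀ : ℕ, ∀ n ≥ n₀, ∀ δ ∈ Set.Ioo (0 : ℝ) (Real.exp (-1)),
          P {ω | ¬ ∫⁻ y, ENNReal.ofReal
                |cqcHat (optRadius d γ n) (optRadius d β n) (piHat n (firstSplit Z n ω))
                  (firstSplit Z n ω) (secondSplit Z n ω) y x - g y x| ∂M.untreatedLaw
              ≤ ENNReal.ofReal (Cg₂ * Metric.diam 𝒴 / (ξ * η) *
                (Real.log (contrastRate d α β γ n * n / δ) ^ (3 / 2 : ℝ) /
                  contrastRate d α β γ n))}
            ≤ ENNReal.ofReal δ) := by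
  refine ⟨contrastConst C Cα Cβ C₀, 1, 1, contrastConst_pos (zero_le_one.trans hC) hα.le hβ.le,
    one_pos, one_pos, ?_⟩
  intro d M 𝒳 𝒴 x Ω _ P _ Z piHat α β γ ξ g h hg
  refine ⟨?_, fun y hy s η hs hη hdens δ hδ => ?_, fun η hη hconn hdens => ?_⟩
  · obtain ⟨n₀, hn₀⟩ := eventually_atTop.1
      (h.eventually_measure_contrastHat_le hC hα hβ h₀ |>.and (eventually_ge_atTop 1))
    refine ⟨n₀, fun n hn δ hδ y₀ hy₀ y₁ hy₁ =>
      le_trans (measure_mono ?_) ((hn₀ n hn).1 δ hδ y₀ hy₀ y₁ hy₁)⟩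
    intro ω hω hle
    refine hω (hle.trans ?_)
    have hE := contrastRate_pos (d := d) (α := α) (β := β) (γ := γ) (hn₀ n hn).2
    have hξ := h.overlap_const.1
    have hK := contrastConst_pos (C₀ := C₀) (zero_le_one.trans hC) hα.le hβ.le
    have hL := one_le_log_one_div hδ
    gcongr
    exact Real.self_le_rpow_of_one_le hL (by norm_num)
  · exact eventually_atTop.1 (h.eventually_measure_cqcHat_le hg hC hα hβ h₀ hy hs hη hdens hδ)
  · exact eventually_atTop.1
      (h.eventually_measure_lintegral_cqcHat_le hg hC hα hβ h₀ hη hconn hdens)
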